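/- **Setting.** Let $n\ge 1$. For $\eta>0$ let $\phi_\eta(z)=\eta^{-n}(2\pi)^{-n/2}e^{-\|z\|^2/(2\eta^2)}$ and $f_\eta(x)=\int_{\mathbb R^n} f(x-z)\,\phi_\eta(z)\,dz$. The function $f:\mathbb R^n\to\mathbb R$ is bounded below, $f^*=\inf f$, and one of the following three regimes holds, which fixes a sample law $Q$, a sampled integrand $G(x,s)$ and a constant $L_0\ge 0$ (all integrands, densities and fields are jointly measurable). 1. *Decision-independent.* $f(x)=\mathbb E_{\xi\sim Q}[F(x,\xi)]$ with $F(x,\cdot)$ integrable, $\|F(x,\cdot)-F(y,\cdot)\|_{L^2(Q)}\le L_0\|x-y\|$ for all $x,y$, and $G=F$. 2. *Decision-dependent, known density.* $f(x)=\int_{\Xi(x)}\hat F(x,s)\,p(s|x)\,ds$, where $p(\cdot|x)$ is a probability density that is positive exactly on $\Xi(x)$, and $\tilde p$ is a probability density that is positive on every $\Xi(x)$. For all $x,y$: the symmetric Kullback–Leibler divergence of $p(\cdot|x)$ and $p(\cdot|y)$ is at most $L_\xi^2\|x-y\|^2$; $p(s|x)/\tilde p(s)\le M$ on $\Xi(x)$;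 $\|\hat F(x,\cdot)-\hat F(y,\cdot)\|_{L^2(\tilde p)}\le\hat L_f\|x-y\|$; $|\hat F(x,s)|\le M_f$ for a.e. $s\in\Xi(x)$. Here $Q$ has density $\tilde p$, $G(x,s)=\hat F(x,s)p(s|x)/\tilde p(s)$ and $L_0=\sqrt{2(M^2\hat L_f^2+MM_f^2L_\xi^2)}$. 3. *Decision-dependent, unknown density.* $f(x)=\mathbb E_{\xi\sim\mathcal D(x)}[\hat F(x,\xi)]$, where $\hat F(x,\cdot)$ is $\mathcal D(x)$-integrable and the laws $\mathcal D(x)$ are the marginals of a random field $(\xi_x)_{x\in\mathbb R^n}$ such that $\|\hat F(x,\xi_x)-\hat F(y,\xi_y)\|_{L^2}\le L_0\|x-y\|$ for all $x,y$. A sample $s\sim Q$ is a realization of the field, and $G(x,s)=\hat F(x,\xi_x(s))$. The exponentially shifted Gaussian smoothing (esGs) estimator $\tilde g_\eta(x,v,z,s)\in\mathbb R^n$ has components $$\tilde g^i_\eta(x,v,z,s)=\tfrac{1}{\eta\sqrt{2\pi}}\left[G\big((x_i+\eta\sqrt{2v},\,x^{-i}-z^{-i}),s\big)-G\big((x_i-\eta\sqrt{2v},\,x^{-i}-z^{-i}),s\big)\right],\quad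 i=1,\dots,n,$$ and uses $2n$ oracle calls (evaluations of $G$). Given a deterministic $x_0$ and sequences $\gamma_k,\eta_k>0$, let $x_{k+1}=x_k-\gamma_k\,\tilde g_{\eta_k}(x_k,V_k,Z_k,\xi_k)$, where $V_k\sim\mathrm{Exp}(1)$, $Z_k\sim\mathcal N(0,\eta_k^2I)$ and $\xi_k\sim Q$ are independent of each other and over $k$. For $K\ge1$ let $R_K$ be a random index, independent of $(x_k)_k$, with $\mathbb P[R_K=j]=\gamma_j/\sum_{l<K}\gamma_l$ for $0\le j\le K-1$. **Proposition (stationarity estimate).** Each $f_{\eta_k}$ is differentiable, the expectations below are finite, and for every $K\ge 1$ the following hold. (a) $$\frac{\sum_{k=0}^{K-1}\gamma_k\,\mathbb E\|\nabla f_{\eta_k}(x_k)\|^2}{\sum_{k=0}^{K-1}\gamma_k}\le B_K:=\frac{1}{\sum_{k=0}^{K-1}\gamma_k}\Big[f(x_0)-f^*+L_0\sqrt{n+1}\sum_{k=1}^{K-1}|\eta_k-\eta_{k-1}|+L_0\sqrt{n+1}\,(\eta_0+\eta_K)+\frac{4L_0^3n^{3/2}}{\sqrt2\,\pi^{3/2}}\sum_{k=0}^{K-1}\frac{\gamma_k^2}{\eta_k}\Big].$$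 (b) $\mathbb E\|\nabla f_{\eta_{R_K}}(x_{R_K})\|^2\le B_K$. **Proposition (iteration and sample complexity).** Write $\Delta=f(x_0)-f^*$. There are an absolute constant $C$ and a function $C':\mathbb R\to\mathbb R$ such that the following holds in all instances as above with $L_0>0$. Let $\eta,\varepsilon>0$, $\eta_k=\eta$ and $\gamma_k=\frac{\eta}{L_0\sqrt n\sqrt{k+1}}$. Then there is a least number $K_{\eta,\varepsilon}\ge1$ of steps $K$ for which $x_{R_K}$ is $(\eta,\varepsilon)$-stationary, that is, $\mathbb E\|\nabla f_\eta(x_{R_K})\|^2\le\varepsilon^2$. With $\Lambda(Y)=Y(1+\ln(1+Y))^2$, $$K_{\eta,\varepsilon}\le 1+C\,\Lambda\big((L_0^2n\Delta^2\eta^{-2}+L_0^4n^2)\,\varepsilon^{-4}\big),\qquad K_{\eta,\varepsilon}\le 1+C'(\Delta^2/\eta)\,\Lambda\big((L_0^2n\,\eta^{-1}+L_0^4n^2)\,\varepsilon^{-4}\big).$$ That is, $K_{\eta,\varepsilon}=\tilde{\mathcal O}\big((L_0^2n\eta^{-1}+L_0^4n^2)\varepsilon^{-4}\big)$ with a hidden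 constant that depends only on $\Delta^2/\eta$. The number $S_{\eta,\varepsilon}$ of oracle calls made in these $K_{\eta,\varepsilon}$ steps is at most $2n$ times each of the two right-hand sides. -/

import Mathlib

open MeasureTheory ProbabilityTheory

universe u w

noncomputable section

namespace ESGS

/-- `ℝⁿ` with the Euclidean norm. -/
abbrev Vec (n : ℕ) := EuclideanSpace ℝ (Fin n)

/-! ### Gaussian smoothing -/

/-- The standard Gaussian density `φ` on `ℝⁿ`. -/
def gaussianKernel (n : ℕ) (z : Vec n) : ℝ :=
  (√((2 * Real.pi) ^ n))⁻¹ * Real.exp (-(∑ i, z i ^ 2) / 2)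

/-- The rescaled kernel `φ_η(z) = η⁻ⁿ φ(η⁻¹ z)`. -/
def scaledKernel (n : ℕ) (η : ℝ) (z : Vec n) : ℝ :=
  (η ^ n)⁻¹ * gaussianKernel n (η⁻¹ • z)

/-- The smoothed function `f_η = f * φ_η`. -/
def smoothed {n : ℕ} (η : ℝ) (f : Vec n → ℝ) (x : Vec n) : ℝ :=
  ∫ z, f (x - z) * scaledKernel n η z

/-- The Gaussian law `N(0, η² I)` on `ℝⁿ`. -/
def gaussianLaw (n : ℕ) (η : ℝ) : Measure (Vec n) :=
  (stdGaussian (Vec n)).map (fun z => η • z)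

/-! ### The exponentially shifted estimator and the stochastic gradient scheme -/

/-- The point `(x_i + η √(2v), x^{-i} - z^{-i})`. -/
def shiftPlus {n : ℕ} (η : ℝ) (x : Vec n) (v : ℝ) (z : Vec n) (i : Fin n) : Vec n :=
  WithLp.toLp 2 fun j => if j = i then x j + η * √(2 * v) else x j - z j

/-- The point `(x_i - η √(2v), x^{-i} - z^{-i})`. -/
def shiftMinus {n : ℕ} (η : ℝ) (x : Vec n) (v : ℝ) (z : Vec n) (i : Fin n) : Vec n :=
  WithLp.toLp 2 fun j => if j = i then x j - η * √(2 * v) else x j - z j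

/-- The exponentially shifted Gaussian smoothing estimator `g̃_η(x, v, z, s)`, built from
values of the sampled integrand `G`. -/
def estimator {n : ℕ} {S : Type*} (G : Vec n → S → ℝ) (η : ℝ) (x : Vec n) (v : ℝ) (z : Vec n)
    (s : S) : Vec n :=
  WithLp.toLp 2 fun i =>
    1 / (η * √(2 * Real.pi)) * (G (shiftPlus η x v z i) s - G (shiftMinus η x v z i) s)

/-- The iterates `x_{k+1} = x_k - γ_k g̃_{η_k}(x_k, V_k, Z_k, ξ_k)`, started at `x₀`. -/
def iterate {n : ℕ} {S Ω : Type*} (G : Vec n → S → ℝ) (γ η : ℕ → ℝ) (V : ℕ → Ω → ℝ)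
    (Z : ℕ → Ω → Vec n) (ξ : ℕ → Ω → S) (x₀ : Vec n) : ℕ → Ω → Vec n
  | 0, _ => x₀
  | k + 1, ω =>
      iterate G γ η V Z ξ x₀ k ω -
        γ k • estimator G (η k) (iterate G γ η V Z ξ x₀ k ω) (V k ω) (Z k ω) (ξ k ω)

/-- The oracle calls (arguments at which the sampled integrand is evaluated) made in one
evaluation of `estimator`. -/
def estimatorCalls {n : ℕ} {S : Type*} (η : ℝ) (x : Vec n) (v : ℝ) (z : Vec n) (s : S) :
    List (Vec n × S) :=
  (List.finRange n).flatMap fun i => [(shiftPlus η x v z i, s), (shiftMinus η x v z i, s)]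

/-- All oracle calls made by the scheme in its first `K` iterations. -/
def oracleCalls {n : ℕ} {S Ω : Type*} (G : Vec n → S → ℝ) (γ η : ℕ → ℝ) (V : ℕ → Ω → ℝ)
    (Z : ℕ → Ω → Vec n) (ξ : ℕ → Ω → S) (x₀ : Vec n) (K : ℕ) (ω : Ω) : List (Vec n × S) :=
  (List.range K).flatMap fun k =>
    estimatorCalls (η k) (iterate G γ η V Z ξ x₀ k ω) (V k ω) (Z k ω) (ξ k ω)

/-- The algorithmic noise: the triples `(V_k, Z_k, ξ_k)` are independent over `k`, and for each
`k` the three components are independent with laws `Exp(1)`, `N(0, η_k² I)` and `Q`. -/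
structure IsNoise {n : ℕ} {S Ω : Type*} [MeasurableSpace S] [MeasurableSpace Ω] (μ : Measure Ω)
    (Q : Measure S) (η : ℕ → ℝ) (V : ℕ → Ω → ℝ) (Z : ℕ → Ω → Vec n) (ξ : ℕ → Ω → S) :
    Prop where
  measurable_V : ∀ k, Measurable (V k)
  measurable_Z : ∀ k, Measurable (Z k)
  measurable_ξ : ∀ k, Measurable (ξ k)
  law : ∀ k, μ.map (fun ω => (V k ω, Z k ω, ξ k ω)) =
    (expMeasure 1).prod ((gaussianLaw n (η k)).prod Q)
  indep : iIndepFun (fun k ω => (V k ω, Z k ω, ξ k ω)) μ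

/-- `R` is a random index in `{0, …, K-1}` with `ℙ[R = j] = γ_j / ∑_{l<K} γ_l`, independent of
the process `x`. -/
structure IsRandomIndex {n : ℕ} {Ω : Type*} [MeasurableSpace Ω] (μ : Measure Ω) (γ : ℕ → ℝ)
    (x : ℕ → Ω → Vec n) (K : ℕ) (R : Ω → ℕ) : Prop where
  measurable : Measurable R
  lt : ∀ ω, R ω < K
  prob : ∀ j < K, μ (R ⁻¹' {j}) = ENNReal.ofReal (γ j / ∑ l ∈ Finset.range K, γ l)
  indep : IndepFun R (fun ω k => x k ω) μ

/-! ### The three stochastic optimization regimes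

`Q` is the law of the sample `ξ_k` drawn by the algorithm, `G` is the sampled integrand that enters
the estimator, `f` is the objective and `L₀` is the Lipschitz modulus of the regime. -/

/-- Decision-independent regime: `f(x) = 𝔼[F(x, ξ)]` with `ξ ∼ Q`, and `F` is `L₀`-Lipschitz in
`x` with respect to the `L²(ξ)` norm. -/
structure DecisionIndependent {n : ℕ} {S : Type*} [MeasurableSpace S] (Q : Measure S)
    (F : Vec n → S → ℝ) (f : Vec n → ℝ) (L₀ : ℝ) : Prop where
  isProbability : IsProbabilityMeasure Q
  measurable : Measurable (Function.uncurry F)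
  integrable : ∀ x, Integrable (F x) Q
  lipschitz : ∀ x y, eLpNorm (fun s => F x s - F y s) 2 Q ≤ ENNReal.ofReal (L₀ * ‖x - y‖)
  objective : ∀ x, f x = ∫ s, F x s ∂Q

/-- The assumptions on a decision-dependent integrand `F` with known density `p(⬝ | x)`, whose
support is `Ξ x`, and sampling density `q` (densities with respect to `lam`). -/
structure KnownDensity {n : ℕ} {S : Type*} [MeasurableSpace S] (lam : Measure S)
    (F p : Vec n → S → ℝ) (q : S → ℝ) (Ξ : Vec n → Set S) (M L_f M_f L_ξ : ℝ) : Prop where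
  sigmaFinite : SigmaFinite lam
  measurable_F : Measurable (Function.uncurry F)
  measurable_p : Measurable (Function.uncurry p)
  measurable_q : Measurable q
  p_pos : ∀ x, ∀ s ∈ Ξ x, 0 < p x s
  p_zero : ∀ x, ∀ s ∉ Ξ x, p x s = 0
  p_density : ∀ x, IsProbabilityMeasure (lam.withDensity fun s => ENNReal.ofReal (p x s))
  q_nonneg : ∀ s, 0 ≤ q s
  q_pos : ∀ x, ∀ s ∈ Ξ x, 0 < q s
  q_density : IsProbabilityMeasure (lam.withDensity fun s => ENNReal.ofReal (q s))
  /-- symmetric Kullback-Leibler divergence -/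
  kl_le : ∀ x y,
    InformationTheory.klDiv (lam.withDensity fun s => ENNReal.ofReal (p x s))
        (lam.withDensity fun s => ENNReal.ofReal (p y s)) +
      InformationTheory.klDiv (lam.withDensity fun s => ENNReal.ofReal (p y s))
        (lam.withDensity fun s => ENNReal.ofReal (p x s)) ≤
      ENNReal.ofReal (L_ξ ^ 2 * ‖x - y‖ ^ 2)
  ratio_le : ∀ x, ∀ s ∈ Ξ x, p x s / q s ≤ M
  lipschitz : ∀ x y,
    eLpNorm (fun s => F x s - F y s) 2 (lam.withDensity fun s => ENNReal.ofReal (q s)) ≤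
      ENNReal.ofReal (L_f * ‖x - y‖)
  bounded : ∀ x, ∀ᵐ s ∂lam, s ∈ Ξ x → |F x s| ≤ M_f

/-- Decision-dependent regime with known density: `f(x) = ∫_{Ξ(x)} F(x, s) p(s | x) ds`. The
algorithm draws `ξ` from the density `q` and evaluates `F(x, ξ) p(ξ | x) / q(ξ)`. -/
def DecisionDependentKnown {n : ℕ} {S : Type*} [MeasurableSpace S] (Q : Measure S)
    (G : Vec n → S → ℝ) (f : Vec n → ℝ) (L₀ : ℝ) : Prop :=
  ∃ (lam : Measure S) (F p : Vec n → S → ℝ) (q : S → ℝ) (Ξ : Vec n → Set S)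
    (M L_f M_f L_ξ : ℝ),
    KnownDensity lam F p q Ξ M L_f M_f L_ξ ∧
    Q = lam.withDensity (fun s => ENNReal.ofReal (q s)) ∧
    (∀ x s, G x s = F x s * p x s / q s) ∧
    (∀ x, f x = ∫ s in Ξ x, F x s * p x s ∂lam) ∧
    L₀ = √(2 * (M ^ 2 * L_f ^ 2 + M * M_f ^ 2 * L_ξ ^ 2))

/-- The assumptions on a decision-dependent integrand `F` with unknown distributions `D x`, which
are the marginals of a random field `X` on the probability space `(S, Q)`; the Lipschitz property
is in the `L²` metric of the field. -/
structure UnknownDensity {n : ℕ} {S T : Type*} [MeasurableSpace S] [MeasurableSpace T]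
    (Q : Measure S) (X : Vec n → S → T) (D : Vec n → Measure T) (F : Vec n → T → ℝ) (L₀ : ℝ) :
    Prop where
  isProbability : IsProbabilityMeasure Q
  measurable_X : Measurable (Function.uncurry X)
  marginal : ∀ x, Q.map (X x) = D x
  measurable_F : Measurable (Function.uncurry F)
  integrable : ∀ x, Integrable (F x) (D x)
  lipschitz : ∀ x y,
    eLpNorm (fun s => F x (X x s) - F y (X y s)) 2 Q ≤ ENNReal.ofReal (L₀ * ‖x - y‖)

/-- Decision-dependent regime with unknown density: `f(x) = 𝔼_{ξ ∼ D(x)}[F(x, ξ)]`. The oracle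
draws one realization `s` of the random field and returns the values `F(x, X_x(s))` at all the
points `x` that it is asked for. -/
def DecisionDependentUnknown {n : ℕ} {S : Type u} [MeasurableSpace S] (Q : Measure S)
    (G : Vec n → S → ℝ) (f : Vec n → ℝ) (L₀ : ℝ) : Prop :=
  ∃ (T : Type u) (_ : MeasurableSpace T) (X : Vec n → S → T) (D : Vec n → Measure T)
    (F : Vec n → T → ℝ),
    UnknownDensity Q X D F L₀ ∧
    (∀ x s, G x s = F x (X x s)) ∧
    (∀ x, f x = ∫ t, F x t ∂(D x))

/-- One of the three regimes holds. -/
def Regime {n : ℕ} {S : Type u} [MeasurableSpace S] (Q : Measure S)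
    (G : Vec n → S → ℝ) (f : Vec n → ℝ) (L₀ : ℝ) : Prop :=
  DecisionIndependent Q G f L₀ ∨ DecisionDependentKnown Q G f L₀ ∨
    DecisionDependentUnknown Q G f L₀

/-! ### Convergence measures -/

/-- The right-hand side of the stationarity estimate after `K` steps. -/
def stationarityBound {n : ℕ} (f : Vec n → ℝ) (x₀ : Vec n) (L₀ : ℝ) (γ η : ℕ → ℝ) (K : ℕ) : ℝ :=
  1 / (∑ k ∈ Finset.range K, γ k) *
    (f x₀ - (⨅ x, f x) + L₀ * √(n + 1) * ∑ k ∈ Finset.Ico 1 K, |η k - η (k - 1)| +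
      L₀ * √(n + 1) * (η 0 + η K) +
      4 * L₀ ^ 3 * (n : ℝ) ^ (3 / 2 : ℝ) / (√2 * Real.pi ^ (3 / 2 : ℝ)) *
        ∑ k ∈ Finset.range K, γ k ^ 2 / η k)

/-- The numbers `K ≥ 1` of steps after which the randomly selected iterate `x_{R_K}` is
`(η, ε)`-stationary, `𝔼‖∇f_η(x_{R_K})‖² ≤ ε²`. -/
def stationarySteps {n : ℕ} {Ω : Type*} [MeasurableSpace Ω] (μ : Measure Ω) (f : Vec n → ℝ)
    (η ε : ℝ) (x : ℕ → Ω → Vec n) (R : ℕ → Ω → ℕ) : Set ℕ :=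
  {K | 0 < K ∧ Integrable (fun ω => ‖gradient (smoothed η f) (x (R K ω) ω)‖ ^ 2) μ ∧
    ∫ ω, ‖gradient (smoothed η f) (x (R K ω) ω)‖ ^ 2 ∂μ ≤ ε ^ 2}

/-- The iteration complexity `K_{η,ε}`: the least element of `stationarySteps`. -/
def iterationComplexity {n : ℕ} {Ω : Type*} [MeasurableSpace Ω] (μ : Measure Ω) (f : Vec n → ℝ)
    (η ε : ℝ) (x : ℕ → Ω → Vec n) (R : ℕ → Ω → ℕ) : ℕ :=
  sInf (stationarySteps μ f η ε x R)

/-- `Y` with the poly-logarithmic factor that `Õ(Y)` suppresses. -/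
def withLog (Y : ℝ) : ℝ := Y * (1 + Real.log (1 + Y)) ^ 2

end ESGS

end

noncomputable section

namespace ESGS

/-! ### Reduction of the three regimes to the decision-independent one -/

/-! All three regimes reduce to one situation: under a fixed law `Q` the integrand `G x` has mean `f
x` and is `L₀`-Lipschitz in `x` in mean square (`Regime.decisionIndependent`). For a known density
this is importance sampling. Changing `p(⬝ | x)` to `p(⬝ | y)` costs `(p x - p y)² / q`, and this is
at most `M` times the integrand of the symmetric Kullback-Leibler divergence. In particular `f` is
`L₀`-Lipschitz.

The estimator is unbiased because `exp (-s² / 2)` is the tail probability `ℙ[V > s² / 2]` of an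
`Exp(1)` variable. By Fubini, the Gaussian mean of `g' (η s)` becomes the mean over `V` of the
integral of `g' (η s)` over `|s| < √(2V)`, which is a symmetric difference of `g`
(`integral_deriv_gaussianReal_eq`). Using this in one coordinate, with the others frozen, gives a
derivative-free formula for the gradient of `f_η` (`hasGradientAt_smoothed`). The formula shows that
this gradient is Lipschitz with a constant of order `L₀ √n / η`. The two evaluation points lie
`2η√(2V)` apart, so the second moment of the estimator is at most `4 L₀² n / π`, whatever `η` is.

The rest is the analysis of stochastic gradient descent on a smooth function: the descent lemma in
mean, then telescoping. Replacing `η_{k-1}` by `η_k` costs `L₀ √n |η_k - η_{k-1}|`, and `inf f ≤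
f_η` closes the sum. For constant `η` the bound decays like `(1 + log K) / √K`. If the least
admissible `K` exceeds one, its predecessor fails the rate test and so satisfies `K ≤ 32 Y (1 + log
K)²`; feeding a crude bound on `K` into the logarithm resolves this inequality (`le_mul_withLog`).
-/

open InformationTheory in
lemma sq_sub_div_le_klFun {a b q M : ℝ} (ha : 0 < a) (hb : 0 < b) (hq : 0 < q) (haM : a / q ≤ M)
    (hbM : b / q ≤ M) :
    (a - b) ^ 2 / q ≤ M * (b * klFun (a / b) + a * klFun (b / a)) := by
  -- The ordering `b ≤ a` makes both `a - b` and `1 - b / a` nonnegative, so that `a / q ≤ M` and `1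
  -- - b / a ≤ log (a / b)` can be multiplied; the other ordering follows by symmetry.
  have key : ∀ {a b : ℝ}, 0 < a → 0 < b → a / q ≤ M → b ≤ a →
      (a - b) ^ 2 / q ≤ M * ((a - b) * Real.log (a / b)) := by
    intro a b ha hb haM hab
    have h1 : 1 - b / a ≤ Real.log (a / b) := by
      have := Real.one_sub_inv_le_log_of_pos (div_pos ha hb)
      rwa [inv_div] at this
    have h2 : (a - b) ^ 2 / q = a / q * ((a - b) * (1 - b / a)) := by field_simp
    rw [h2]
    have h3 : 0 ≤ 1 - b / a := by
      rw [sub_nonneg]; exact (div_le_one ha).2 hab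
    have h4 : 0 ≤ a - b := sub_nonneg.2 hab
    have hM : 0 ≤ M := le_trans (by positivity) haM
    gcongr
  -- The affine parts of `klFun` cancel in the symmetrised sum.
  have h : b * klFun (a / b) + a * klFun (b / a) = (a - b) * Real.log (a / b) := by
    have hl : Real.log (b / a) = -Real.log (a / b) := by rw [← Real.log_inv, inv_div]
    simp only [klFun_apply, hl]
    field_simp
    ring
  rw [h]
  rcases le_total b a with hab | hab
  · exact key ha hb haM hab
  · have := key hb ha hbM hab
    have hl : Real.log (b / a) = -Real.log (a / b) := by rw [← Real.log_inv, inv_div]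
    rw [hl] at this
    calc (a - b) ^ 2 / q = (b - a) ^ 2 / q := by ring
      _ ≤ _ := this
      _ = _ := by ring

/-! ### Kullback-Leibler divergence between laws given by densities -/

section KL

variable {S : Type*} [MeasurableSpace S] {lam : Measure S}

lemma ae_eq_zero_of_withDensity_absolutelyContinuous {a b : S → ℝ} (ha : Measurable a)
    (hb : Measurable b) (ha0 : ∀ s, 0 ≤ a s)
    (h : lam.withDensity (fun s => ENNReal.ofReal (a s)) ≪
      lam.withDensity (fun s => ENNReal.ofReal (b s))) :
    ∀ᵐ s ∂lam, b s = 0 → a s = 0 := by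
  have hms : MeasurableSet {s | b s = 0} := hb (measurableSet_singleton 0)
  have h0 : lam.withDensity (fun s => ENNReal.ofReal (b s)) {s | b s = 0} = 0 := by
    rw [withDensity_apply _ hms, setLIntegral_congr_fun (g := fun _ => 0) hms]
    · simp
    · intro s hs
      have : b s = 0 := hs
      simp [this]
  have h1 := h h0
  rw [withDensity_apply _ hms, lintegral_eq_zero_iff (by fun_prop)] at h1
  rw [Filter.EventuallyEq, ae_restrict_iff' hms] at h1
  filter_upwards [h1] with s hs hbs
  exact le_antisymm (ENNReal.ofReal_eq_zero.1 (hs hbs)) (ha0 s)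

open InformationTheory in
-- The quotient `a / b` is a version of the Radon-Nikodym derivative: by absolute continuity `a`
-- vanishes a.e. where `b` does, so the convention `a / 0 = 0` does no harm.
lemma klDiv_withDensity_eq_lintegral {a b : S → ℝ} (ha : Measurable a)
    (hb : Measurable b) (ha0 : ∀ s, 0 ≤ a s) (hb0 : ∀ s, 0 ≤ b s)
    [IsProbabilityMeasure (lam.withDensity fun s => ENNReal.ofReal (a s))]
    [IsProbabilityMeasure (lam.withDensity fun s => ENNReal.ofReal (b s))]
    (h : lam.withDensity (fun s => ENNReal.ofReal (a s)) ≪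
      lam.withDensity (fun s => ENNReal.ofReal (b s))) :
    klDiv (lam.withDensity fun s => ENNReal.ofReal (a s))
        (lam.withDensity fun s => ENNReal.ofReal (b s)) =
      ∫⁻ s, ENNReal.ofReal (b s * klFun (a s / b s)) ∂lam := by
  have hae := ae_eq_zero_of_withDensity_absolutelyContinuous ha hb ha0 h
  have hAB : lam.withDensity (fun s => ENNReal.ofReal (a s)) =
      (lam.withDensity (fun s => ENNReal.ofReal (b s))).withDensity
        (fun s => ENNReal.ofReal (a s / b s)) := by
    rw [← withDensity_mul _ (by fun_prop) (by fun_prop)]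
    apply withDensity_congr_ae
    filter_upwards [hae] with s hs
    simp only [Pi.mul_apply]
    rw [← ENNReal.ofReal_mul (hb0 s)]
    congr 1
    rcases eq_or_ne (b s) 0 with h0 | h0
    · simp [h0, hs h0]
    · field_simp
  rw [klDiv_eq_lintegral_klFun_of_ac h]
  have hrn := Measure.rnDeriv_withDensity (lam.withDensity (fun s => ENNReal.ofReal (b s)))
    (f := fun s => ENNReal.ofReal (a s / b s)) (by fun_prop)
  rw [← hAB] at hrn
  rw [lintegral_congr_ae (g := fun s => ENNReal.ofReal (klFun (a s / b s)))]
  · rw [lintegral_withDensity_eq_lintegral_mul _ (by fun_prop)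
      (by have := measurable_klFun; fun_prop)]
    refine lintegral_congr fun s => ?_
    rw [Pi.mul_apply, ← ENNReal.ofReal_mul (hb0 s)]
  · filter_upwards [hrn] with s hs
    rw [hs, ENNReal.toReal_ofReal (div_nonneg (ha0 s) (hb0 s))]

end KL

/-- Split the difference as `(F - H) (a / q) + H (a - b) / q`, a change of integrand plus a change
of density, and use `(u + v)² ≤ 2u² + 2v²`. -/
lemma mul_sq_sub_div_le {F H a b q M Mf : ℝ} (hq : 0 < q) (ha : 0 < a) (haM : a / q ≤ M)
    (hH : |H| ≤ Mf) :
    q * (F * a / q - H * b / q) ^ 2 ≤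
      2 * M ^ 2 * (q * (F - H) ^ 2) + 2 * Mf ^ 2 * ((a - b) ^ 2 / q) := by
  have h1 : q * (F * a / q - H * b / q) ^ 2 =
      q * ((F - H) * (a / q) + H * ((a - b) / q)) ^ 2 := by
    field_simp; ring
  have h2 : (a / q) ^ 2 ≤ M ^ 2 := by
    have : 0 ≤ a / q := by positivity
    gcongr
  have h3 : H ^ 2 ≤ Mf ^ 2 := by
    rw [← sq_abs]; gcongr
  rw [h1]
  calc q * ((F - H) * (a / q) + H * ((a - b) / q)) ^ 2
      ≤ q * (2 * ((F - H) * (a / q)) ^ 2 + 2 * (H * ((a - b) / q)) ^ 2) := by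
        gcongr
        nlinarith [sq_nonneg ((F - H) * (a / q) - H * ((a - b) / q))]
    _ = 2 * (a / q) ^ 2 * (q * (F - H) ^ 2) + 2 * H ^ 2 * ((a - b) ^ 2 / q) := by
        field_simp
    _ ≤ _ := by gcongr

lemma eLpNorm_two_le_iff {S : Type*} [MeasurableSpace S] {Q : Measure S} {g : S → ℝ} {c : ℝ}
    (hc : 0 ≤ c) :
    eLpNorm g 2 Q ≤ ENNReal.ofReal c ↔
      ∫⁻ s, ENNReal.ofReal (g s ^ 2) ∂Q ≤ ENNReal.ofReal (c ^ 2) := by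
  have h : eLpNorm g 2 Q ^ (2 : ℝ) = ∫⁻ s, ENNReal.ofReal (g s ^ 2) ∂Q := by
    have := eLpNorm_nnreal_pow_eq_lintegral (f := g) (μ := Q) (p := 2) (by norm_num)
    simp only [ENNReal.coe_ofNat, NNReal.coe_ofNat] at this
    rw [this]
    refine lintegral_congr fun s => ?_
    rw [Real.enorm_eq_ofReal_abs, ENNReal.rpow_ofNat, ← ENNReal.ofReal_pow (abs_nonneg _), sq_abs]
  rw [← h, ENNReal.ofReal_pow hc, ← ENNReal.rpow_ofNat]
  exact (ENNReal.rpow_le_rpow_iff (by norm_num)).symm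

/-! ### Importance sampling and random fields as decision-independent problems -/

section Regimes

variable {n : ℕ} {S : Type u} [MeasurableSpace S] {Q : Measure S} {G : Vec n → S → ℝ}
  {f : Vec n → ℝ} {L₀ : ℝ}

namespace KnownDensity

variable {lam : Measure S} {F p : Vec n → S → ℝ} {q : S → ℝ} {Ξ : Vec n → Set S}
  {M L_f M_f L_ξ : ℝ}

lemma p_nonneg (h : KnownDensity lam F p q Ξ M L_f M_f L_ξ) (x : Vec n) (s : S) : 0 ≤ p x s := by
  by_cases hs : s ∈ Ξ x
  · exact (h.p_pos x s hs).le
  · rw [h.p_zero x s hs]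

lemma mem_iff (h : KnownDensity lam F p q Ξ M L_f M_f L_ξ) (x : Vec n) (s : S) :
    s ∈ Ξ x ↔ p x s ≠ 0 :=
  ⟨fun hs => (h.p_pos x s hs).ne', fun hs => by_contra fun h' => hs (h.p_zero x s h')⟩

lemma measurable_p_apply (h : KnownDensity lam F p q Ξ M L_f M_f L_ξ) (x : Vec n) :
    Measurable (p x) :=
  h.measurable_p.comp measurable_prodMk_left

lemma measurable_F_apply (h : KnownDensity lam F p q Ξ M L_f M_f L_ξ) (x : Vec n) :
    Measurable (F x) :=
  h.measurable_F.comp measurable_prodMk_left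

/-- A negative `M` would force `Ξ 0` to be empty, so `p 0` would vanish and could not have total
mass one. -/
lemma M_nonneg (h : KnownDensity lam F p q Ξ M L_f M_f L_ξ) : 0 ≤ M := by
  have := h.p_density 0
  by_contra hM
  have h0 : ∀ s, p 0 s = 0 := fun s => by
    refine h.p_zero 0 s fun hs => hM ?_
    exact (div_pos (h.p_pos 0 s hs) (h.q_pos 0 s hs)).le.trans (h.ratio_le 0 s hs)
  have h1 := this.measure_univ
  simp [h0] at h1

lemma integrable_p (h : KnownDensity lam F p q Ξ M L_f M_f L_ξ) (x : Vec n) :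
    Integrable (p x) lam := by
  refine ⟨(h.measurable_p_apply x).aestronglyMeasurable, ?_⟩
  rw [hasFiniteIntegral_iff_ofReal (Filter.Eventually.of_forall (h.p_nonneg x))]
  have h1 := (h.p_density x).measure_univ
  rw [withDensity_apply _ MeasurableSet.univ, Measure.restrict_univ] at h1
  rw [h1]
  exact ENNReal.one_lt_top

lemma integrable_mul (h : KnownDensity lam F p q Ξ M L_f M_f L_ξ) (x : Vec n) :
    Integrable (fun s => F x s * p x s) lam := by
  refine ((h.integrable_p x).const_mul M_f).mono'
    ((h.measurable_F_apply x).mul (h.measurable_p_apply x)).aestronglyMeasurable ?_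
  filter_upwards [h.bounded x] with s hs
  rw [norm_mul, Real.norm_eq_abs, Real.norm_eq_abs, abs_of_nonneg (h.p_nonneg x s)]
  by_cases hm : s ∈ Ξ x
  · exact mul_le_mul_of_nonneg_right (hs hm) (h.p_nonneg x s)
  · simp [h.p_zero x s hm]

/-- The importance weights cancel at every `s`, even where `q` vanishes, since `p x` is then zero
too. -/
lemma mul_div_cancel (h : KnownDensity lam F p q Ξ M L_f M_f L_ξ) (x : Vec n) (s : S) :
    (ENNReal.ofReal (q s)).toReal • (F x s * p x s / q s) = F x s * p x s := by
  rw [ENNReal.toReal_ofReal (h.q_nonneg s), smul_eq_mul]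
  by_cases hm : s ∈ Ξ x
  · have := h.q_pos x s hm
    field_simp
  · simp [h.p_zero x s hm]

open InformationTheory in
lemma lintegral_sq_le (h : KnownDensity lam F p q Ξ M L_f M_f L_ξ) (x y : Vec n) :
    ∫⁻ s, ENNReal.ofReal ((F x s * p x s / q s - F y s * p y s / q s) ^ 2)
        ∂(lam.withDensity fun s => ENNReal.ofReal (q s)) ≤
      ENNReal.ofReal (2 * (M ^ 2 * L_f ^ 2 + M * M_f ^ 2 * L_ξ ^ 2) * ‖x - y‖ ^ 2) := by
  have := h.p_density x
  have := h.p_density y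
  have hpx := h.measurable_p_apply x
  have hpy := h.measurable_p_apply y
  have hFx := h.measurable_F_apply x
  have hFy := h.measurable_F_apply y
  have hq := h.measurable_q
  have hkf := measurable_klFun
  have hkl := h.kl_le x y
  have hfin := (hkl.trans_lt ENNReal.ofReal_lt_top).ne
  rw [ENNReal.add_ne_top] at hfin
  have hac := (klDiv_ne_top_iff.1 hfin.1).1
  have hca := (klDiv_ne_top_iff.1 hfin.2).1
  -- Finiteness of both divergences makes the two laws mutually absolutely continuous. Hence `p x`
  -- and `p y` vanish a.e. at the same points, and only the common support needs an estimate.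
  have hae1 := ae_eq_zero_of_withDensity_absolutelyContinuous hpx hpy (h.p_nonneg x) hac
  have hae2 := ae_eq_zero_of_withDensity_absolutelyContinuous hpy hpx (h.p_nonneg y) hca
  rw [klDiv_withDensity_eq_lintegral hpx hpy (h.p_nonneg x) (h.p_nonneg y) hac,
    klDiv_withDensity_eq_lintegral hpy hpx (h.p_nonneg y) (h.p_nonneg x) hca,
    ← lintegral_add_left (by fun_prop)] at hkl
  have hlip : ∫⁻ s, ENNReal.ofReal (q s * (F x s - F y s) ^ 2) ∂lam ≤
      ENNReal.ofReal (L_f ^ 2 * ‖x - y‖ ^ 2) := by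
    -- The sign of `L_f` is not prescribed; the absolute value makes squaring legitimate.
    have h1 : eLpNorm (fun s => F x s - F y s) 2 (lam.withDensity fun s => ENNReal.ofReal (q s)) ≤
        ENNReal.ofReal (|L_f| * ‖x - y‖) :=
      (h.lipschitz x y).trans (ENNReal.ofReal_le_ofReal (by gcongr; exact le_abs_self _))
    rw [eLpNorm_two_le_iff (by positivity),
      lintegral_withDensity_eq_lintegral_mul _ (by fun_prop) (by fun_prop), mul_pow, sq_abs] at h1
    refine le_trans (le_of_eq (lintegral_congr fun s => ?_)) h1
    rw [Pi.mul_apply, ENNReal.ofReal_mul (h.q_nonneg s)]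
  have hM := h.M_nonneg
  rw [lintegral_withDensity_eq_lintegral_mul _ (by fun_prop) (by fun_prop)]
  calc _ ≤ ∫⁻ s, (ENNReal.ofReal (2 * M ^ 2) * ENNReal.ofReal (q s * (F x s - F y s) ^ 2) +
          ENNReal.ofReal (2 * M_f ^ 2 * M) * (ENNReal.ofReal (p y s * klFun (p x s / p y s)) +
            ENNReal.ofReal (p x s * klFun (p y s / p x s)))) ∂lam := by
        refine lintegral_mono_ae ?_
        filter_upwards [hae1, hae2, h.bounded y] with s h1 h2 hb
        by_cases hx : p x s = 0
        · simp [hx, h2 hx]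
        have hy : p y s ≠ 0 := fun h' => hx (h1 h')
        have hxm := (h.mem_iff x s).2 hx
        have hym := (h.mem_iff y s).2 hy
        have hqs := h.q_pos x s hxm
        have hxp := h.p_pos x s hxm
        have hyp := h.p_pos y s hym
        have k1 : 0 ≤ klFun (p x s / p y s) := klFun_nonneg (by positivity)
        have k2 : 0 ≤ klFun (p y s / p x s) := klFun_nonneg (by positivity)
        rw [Pi.mul_apply, ← ENNReal.ofReal_mul hqs.le, ← ENNReal.ofReal_mul (by positivity),
          ← ENNReal.ofReal_add (by positivity) (by positivity), ← ENNReal.ofReal_mul (by positivity),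
          ← ENNReal.ofReal_add (by positivity) (by positivity)]
        apply ENNReal.ofReal_le_ofReal
        refine (mul_sq_sub_div_le hqs hxp (h.ratio_le x s hxm) (hb hym)).trans ?_
        rw [mul_assoc (2 * M_f ^ 2) M]
        gcongr
        exact sq_sub_div_le_klFun hxp hyp hqs (h.ratio_le x s hxm) (h.ratio_le y s hym)
    _ = ENNReal.ofReal (2 * M ^ 2) * ∫⁻ s, ENNReal.ofReal (q s * (F x s - F y s) ^ 2) ∂lam +
          ENNReal.ofReal (2 * M_f ^ 2 * M) * ∫⁻ s, (ENNReal.ofReal (p y s * klFun (p x s / p y s)) +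
            ENNReal.ofReal (p x s * klFun (p y s / p x s))) ∂lam := by
        rw [lintegral_add_left (by fun_prop), lintegral_const_mul _ (by fun_prop),
          lintegral_const_mul _ (by fun_prop)]
    _ ≤ ENNReal.ofReal (2 * M ^ 2) * ENNReal.ofReal (L_f ^ 2 * ‖x - y‖ ^ 2) +
          ENNReal.ofReal (2 * M_f ^ 2 * M) * ENNReal.ofReal (L_ξ ^ 2 * ‖x - y‖ ^ 2) := by
        gcongr
    _ = _ := by
        rw [← ENNReal.ofReal_mul (by positivity), ← ENNReal.ofReal_mul (by positivity),
          ← ENNReal.ofReal_add (by positivity) (by positivity)]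
        congr 1
        ring

end KnownDensity

lemma DecisionDependentKnown.decisionIndependent (h : DecisionDependentKnown Q G f L₀) :
    DecisionIndependent Q G f L₀ := by
  obtain ⟨lam, F, p, q, Ξ, M, L_f, M_f, L_ξ, hK, rfl, hG, hf, rfl⟩ := h
  have hG' : G = fun x s => F x s * p x s / q s := by ext x s; exact hG x s
  subst hG'
  have hM := hK.M_nonneg
  have hq := hK.measurable_q
  refine ⟨hK.q_density, ?_, fun x => ?_, fun x y => ?_, fun x => ?_⟩
  · exact (hK.measurable_F.mul hK.measurable_p).div (hK.measurable_q.comp measurable_snd)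
  · rw [integrable_withDensity_iff_integrable_smul' (by fun_prop) (by simp)]
    simp_rw [hK.mul_div_cancel]
    exact hK.integrable_mul x
  · rw [eLpNorm_two_le_iff (by positivity), mul_pow, Real.sq_sqrt (by positivity)]
    exact hK.lintegral_sq_le x y
  · rw [hf x, integral_withDensity_eq_integral_toReal_smul (by fun_prop) (by simp)]
    simp_rw [hK.mul_div_cancel]
    refine setIntegral_eq_integral_of_forall_compl_eq_zero fun s hs => ?_
    simp [hK.p_zero x s hs]

/-- The sample is a realization of the whole field, so its law does not depend on the decision; the
marginals enter only through the change of variables in the mean. -/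
lemma DecisionDependentUnknown.decisionIndependent (h : DecisionDependentUnknown Q G f L₀) :
    DecisionIndependent Q G f L₀ := by
  obtain ⟨T, _, X, D, F, hU, hG, hf⟩ := h
  have hG' : G = fun x s => F x (X x s) := by ext x s; exact hG x s
  subst hG'
  have hX : ∀ x, Measurable (X x) := fun x => hU.measurable_X.comp measurable_prodMk_left
  refine ⟨hU.isProbability, ?_, fun x => ?_, hU.lipschitz, fun x => ?_⟩
  · exact hU.measurable_F.comp (measurable_fst.prodMk hU.measurable_X)
  · have := hU.integrable x
    rw [← hU.marginal x] at this
    exact this.comp_measurable (hX x)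
  · have hF : Measurable (F x) := hU.measurable_F.comp measurable_prodMk_left
    rw [hf x, ← hU.marginal x, integral_map (hX x).aemeasurable hF.aestronglyMeasurable]

/-- In each regime the sampled integrand is an unbiased estimator of the objective which is
Lipschitz in mean square. -/
lemma Regime.decisionIndependent (h : Regime Q G f L₀) : DecisionIndependent Q G f L₀ := by
  rcases h with h | h | h
  · exact h
  · exact h.decisionIndependent
  · exact h.decisionIndependent

end Regimes

/-! ### The standard Gaussian on `ℝⁿ` -/

lemma pi_withDensity {ι : Type*} [Fintype ι] {α : ι → Type*} [∀ i, MeasurableSpace (α i)]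
    (μ : ∀ i, Measure (α i)) [∀ i, SigmaFinite (μ i)] (p : ∀ i, α i → ℝ)
    (hp0 : ∀ i a, 0 ≤ p i a) (hp : ∀ i, Integrable (p i) (μ i)) :
    Measure.pi (fun i => (μ i).withDensity fun a => ENNReal.ofReal (p i a)) =
      (Measure.pi μ).withDensity fun x => ENNReal.ofReal (∏ i, p i (x i)) := by
  have : ∀ i, IsFiniteMeasure ((μ i).withDensity fun a => ENNReal.ofReal (p i a)) := fun i =>
    isFiniteMeasure_withDensity_ofReal (hp i).2
  refine Measure.pi_eq fun s hs => ?_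
  rw [withDensity_apply _ (MeasurableSet.univ_pi hs), Measure.restrict_pi_pi,
    ← ofReal_integral_eq_lintegral_ofReal]
  · rw [integral_fintype_prod_eq_prod (μ := fun i => (μ i).restrict (s i)) (fun i => p i),
      ENNReal.ofReal_prod_of_nonneg fun i _ => integral_nonneg (hp0 i)]
    refine Finset.prod_congr rfl fun i _ => ?_
    rw [withDensity_apply _ (hs i), ofReal_integral_eq_lintegral_ofReal (hp i).restrict
      (Filter.Eventually.of_forall (hp0 i))]
  · exact Integrable.fintype_prod_dep fun i => (hp i).restrict
  · exact Filter.Eventually.of_forall fun x => Finset.prod_nonneg fun i _ => hp0 i _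

lemma gaussianKernel_eq_prod {n : ℕ} (z : Vec n) :
    gaussianKernel n z = ∏ i, gaussianPDFReal 0 1 (z i) := by
  simp only [gaussianPDFReal_def, gaussianKernel, Finset.prod_mul_distrib, Finset.prod_const,
    Finset.card_univ, Fintype.card_fin, ← Real.exp_sum, NNReal.coe_one, mul_one, sub_zero]
  congr 1
  · rw [inv_pow]
    congr 1
    rw [Real.sqrt_eq_iff_mul_self_eq (by positivity) (by positivity), ← mul_pow,
      Real.mul_self_sqrt (by positivity)]
  · rw [← Finset.sum_neg_distrib, Finset.sum_div]

lemma continuous_gaussianKernel (n : ℕ) : Continuous (gaussianKernel n) := by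
  unfold gaussianKernel
  fun_prop

lemma gaussianKernel_nonneg {n : ℕ} (z : Vec n) : 0 ≤ gaussianKernel n z := by
  unfold gaussianKernel
  positivity

lemma stdGaussian_eq_withDensity (n : ℕ) :
    stdGaussian (Vec n) = volume.withDensity fun z => ENNReal.ofReal (gaussianKernel n z) := by
  rw [← map_pi_eq_stdGaussian]
  have h1 : gaussianReal 0 1 =
      volume.withDensity fun a => ENNReal.ofReal (gaussianPDFReal 0 1 a) := by
    rw [gaussianReal_of_var_ne_zero 0 one_ne_zero]
    rfl
  rw [h1, pi_withDensity (fun _ : Fin n => volume) (fun _ => gaussianPDFReal 0 1)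
    (fun _ => gaussianPDFReal_nonneg 0 1) (fun _ => integrable_gaussianPDFReal 0 1)]
  have h2 := (PiLp.volume_preserving_toLp (Fin n)).map_eq
  have h3 : Measurable (WithLp.toLp 2 : (Fin n → ℝ) → Vec n) :=
    (PiLp.volume_preserving_toLp (Fin n)).measurable
  have hk := (continuous_gaussianKernel n).measurable
  ext s hs
  rw [Measure.map_apply h3 hs, withDensity_apply _ (h3 hs), withDensity_apply _ hs, ← h2,
    setLIntegral_map hs (by fun_prop) h3]
  simp_rw [gaussianKernel_eq_prod]
  rfl

lemma smoothed_eq_integral {n : ℕ} {η : ℝ} (hη : 0 < η) (f : Vec n → ℝ) (x : Vec n) :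
    smoothed η f x = ∫ z, f (x - η • z) ∂(stdGaussian (Vec n)) := by
  have hk := (continuous_gaussianKernel n).measurable
  have h := Measure.integral_comp_inv_smul_of_nonneg (volume : Measure (Vec n))
    (fun z => f (x - η • z) * gaussianKernel n z) hη.le
  rw [stdGaussian_eq_withDensity, integral_withDensity_eq_integral_toReal_smul (by fun_prop)
    (by simp)]
  simp_rw [ENNReal.toReal_ofReal (gaussianKernel_nonneg _), smul_eq_mul]
  have h2 : smoothed η f x =
      (η ^ n)⁻¹ * ∫ z, f (x - η • η⁻¹ • z) * gaussianKernel n (η⁻¹ • z) := by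
    rw [smoothed, ← integral_const_mul]
    refine integral_congr_ae (Filter.Eventually.of_forall fun z => ?_)
    simp only [scaledKernel, smul_inv_smul₀ hη.ne']
    ring
  rw [h2, h, finrank_euclideanSpace_fin, smul_eq_mul, ← mul_assoc,
    inv_mul_cancel₀ (by positivity), one_mul]
  simp_rw [mul_comm]

/-- Needed to carry Rademacher's theorem from Lebesgue measure to the Gaussian average around `x`.
-/
lemma ae_stdGaussian_of_ae_volume {n : ℕ} {η : ℝ} (hη : 0 < η) (x : Vec n) {P : Vec n → Prop}
    (h : ∀ᵐ y, P y) : ∀ᵐ z ∂(stdGaussian (Vec n)), P (x - η • z) := by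
  have hac : stdGaussian (Vec n) ≪ volume := by
    rw [stdGaussian_eq_withDensity]
    exact withDensity_absolutelyContinuous _ _
  refine hac.ae_le ?_
  have h1 : ∀ᵐ z : Vec n, P (x - z) :=
    (Measure.measurePreserving_sub_left volume x).quasiMeasurePreserving.ae h
  have h2 : Measure.QuasiMeasurePreserving (fun z : Vec n => η • z) volume volume :=
    Measure.quasiMeasurePreserving_smul (volume : Measure (Vec n)) hη.ne'
  exact h2.ae h1

lemma integrable_norm_stdGaussian (n : ℕ) :
    Integrable (fun z : Vec n => ‖z‖) (stdGaussian (Vec n)) :=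
  IsGaussian.integrable_id.norm

lemma integral_norm_stdGaussian_le (n : ℕ) :
    ∫ z : Vec n, ‖z‖ ∂(stdGaussian (Vec n)) ≤ √n := by
  have hL2 : MemLp (fun z : Vec n => z) 2 (stdGaussian (Vec n)) := IsGaussian.memLp_two_id
  have hi : ∀ i, MemLp (fun z : Vec n => z i) 2 (stdGaussian (Vec n)) := fun i =>
    hL2.of_le (by fun_prop) (Filter.Eventually.of_forall fun z => PiLp.norm_apply_le z i)
  have h1 : ∀ i : Fin n, ∫ z : Vec n, z i ^ 2 ∂(stdGaussian (Vec n)) = 1 := fun i => by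
    have h3 : Measurable (WithLp.toLp 2 : (Fin n → ℝ) → Vec n) :=
      (PiLp.volume_preserving_toLp (Fin n)).measurable
    rw [← map_pi_eq_stdGaussian, integral_map h3.aemeasurable (by fun_prop)]
    have h4 := integral_map (μ := Measure.pi fun _ : Fin n => gaussianReal 0 1)
      (measurable_pi_apply i).aemeasurable
      (f := fun t : ℝ => t ^ 2) (by fun_prop)
    rw [(measurePreserving_eval (fun _ : Fin n => gaussianReal 0 1) i).map_eq] at h4
    simp only
    rw [← h4]
    have := variance_eq_integral (μ := gaussianReal 0 1) (X := id) (by fun_prop)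
    simpa [variance_id_gaussianReal] using this.symm
  have h2 : ∫ z : Vec n, ‖z‖ ^ 2 ∂(stdGaussian (Vec n)) = n := by
    simp_rw [EuclideanSpace.real_norm_sq_eq]
    rw [integral_finsetSum _ fun i _ => (hi i).integrable_sq]
    simp [h1]
  -- Nonnegativity of the variance of `‖z‖` plays the role of Jensen's inequality.
  refine Real.le_sqrt_of_sq_le ?_
  rw [← h2]
  have h5 := variance_nonneg (fun z : Vec n => ‖z‖) (stdGaussian (Vec n))
  rw [variance_eq_sub hL2.norm] at h5
  simpa using h5

lemma measurable_toLp_update {n : ℕ} (i : Fin n) :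
    Measurable fun p : Vec n × ℝ =>
      (WithLp.toLp 2 (Function.update (WithLp.ofLp p.1) i p.2) : Vec n) := by
  refine (PiLp.volume_preserving_toLp (Fin n)).measurable.comp ?_
  rw [measurable_pi_iff]
  intro j
  by_cases h : j = i
  · subst h
    simpa using measurable_snd
  · simp only [Function.update_of_ne h]
    fun_prop

/-- Resampling one coordinate of a product law leaves the law unchanged. This permits integrating
over coordinate `i` while the others stay frozen. -/
lemma map_update_stdGaussian {n : ℕ} (i : Fin n) :
    ((stdGaussian (Vec n)).prod (gaussianReal 0 1)).map
      (fun p => (WithLp.toLp 2 (Function.update (WithLp.ofLp p.1) i p.2) : Vec n)) =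
      stdGaussian (Vec n) := by
  have h3 : Measurable (WithLp.toLp 2 : (Fin n → ℝ) → Vec n) :=
    (PiLp.volume_preserving_toLp (Fin n)).measurable
  have hu : Measurable fun p : (Fin n → ℝ) × ℝ => Function.update p.1 i p.2 := by
    rw [measurable_pi_iff]
    intro j
    by_cases h : j = i
    · subst h
      simpa using measurable_snd
    · simp only [Function.update_of_ne h]
      fun_prop
  have hpi : ((Measure.pi fun _ : Fin n => gaussianReal 0 1).prod (gaussianReal 0 1)).map
      (fun p => Function.update p.1 i p.2) = Measure.pi fun _ : Fin n => gaussianReal 0 1 := by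
    refine (Measure.pi_eq fun s hs => ?_).symm
    rw [Measure.map_apply hu (MeasurableSet.univ_pi hs)]
    have : (fun p : (Fin n → ℝ) × ℝ => Function.update p.1 i p.2) ⁻¹' Set.univ.pi s =
        (Set.univ.pi (Function.update s i Set.univ)) ×ˢ s i := by
      ext p
      simp only [Set.mem_preimage, Set.mem_univ_pi, Set.mem_prod]
      constructor
      · intro h
        refine ⟨fun j => ?_, by simpa using h i⟩
        by_cases hj : j = i
        · subst hj; simp
        · simpa [Function.update_of_ne hj] using h j
      · rintro ⟨h1, h2⟩ j
        by_cases hj : j = i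
        · subst hj; simpa using h2
        · simpa [Function.update_of_ne hj] using h1 j
    rw [this, Measure.prod_prod, Measure.pi_pi, ← Finset.mul_prod_erase _ _ (Finset.mem_univ i),
      ← Finset.mul_prod_erase _ (fun j => gaussianReal 0 1 (s j)) (Finset.mem_univ i)]
    simp only [Function.update_self, measure_univ, one_mul]
    rw [mul_comm]
    congr 1
    refine Finset.prod_congr rfl fun j hj => ?_
    rw [Function.update_of_ne (Finset.ne_of_mem_erase hj)]
  rw [← map_pi_eq_stdGaussian]
  have : (gaussianReal 0 1) = (gaussianReal 0 1).map id := by simp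
  nth_rw 2 [this]
  rw [Measure.map_prod_map _ _ h3 measurable_id, Measure.map_map (measurable_toLp_update i)
    (h3.prodMap measurable_id)]
  nth_rw 2 [← hpi]
  rw [Measure.map_map h3 hu]
  rfl

/-! ### The exponential law and a one-dimensional integration by parts -/

instance : IsProbabilityMeasure (expMeasure 1) := isProbabilityMeasure_expMeasure one_pos

lemma expMeasure_one_Ioi {a : ℝ} (ha : 0 ≤ a) :
    expMeasure 1 (Set.Ioi a) = ENNReal.ofReal (Real.exp (-a)) := by
  have h1 := cdf_expMeasure_eq one_pos a
  rw [if_pos ha, one_mul] at h1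
  have h2 := ofReal_cdf (expMeasure 1) a
  rw [← Set.compl_Iic, prob_compl_eq_one_sub measurableSet_Iic, ← h2, h1,
    ENNReal.ofReal_sub _ (Real.exp_pos _).le, ENNReal.ofReal_one,
    ENNReal.sub_sub_cancel ENNReal.one_ne_top]
  rw [← ENNReal.ofReal_one]
  exact ENNReal.ofReal_le_ofReal (Real.exp_le_one_iff.2 (by linarith))

/-- The layer-cake formula reduces the mean to the integral of the tail `exp (-t)`. -/
lemma lintegral_ofReal_expMeasure_one_le :
    ∫⁻ v, ENNReal.ofReal v ∂(expMeasure 1) ≤ 1 := by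
  have h1 := lintegral_eq_lintegral_meas_lt (expMeasure 1) (f := fun v => max v 0)
    (Filter.Eventually.of_forall fun v => le_max_right _ _) (by fun_prop)
  have h2 : ∀ v : ℝ, ENNReal.ofReal (max v 0) = ENNReal.ofReal v := fun v => by
    rcases le_total v 0 with h | h
    · rw [max_eq_right h, ENNReal.ofReal_of_nonpos h, ENNReal.ofReal_zero]
    · rw [max_eq_left h]
  simp_rw [h2] at h1
  rw [h1, setLIntegral_congr_fun (g := fun t => ENNReal.ofReal (Real.exp (-t))) measurableSet_Ioi,
    ← ofReal_integral_eq_lintegral_ofReal, integral_exp_neg_Ioi_zero, ENNReal.ofReal_one]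
  · exact integrableOn_exp_neg_Ioi 0
  · exact Filter.Eventually.of_forall fun t => (Real.exp_pos _).le
  · intro t ht
    have ht : 0 < t := ht
    simp only
    rw [← expMeasure_one_Ioi ht.le]
    congr 1
    ext v
    simp only [Set.mem_ofPred_eq, Set.mem_Ioi, lt_max_iff]
    exact ⟨fun h => h.resolve_right (by linarith), Or.inl⟩

/-- Write the Gaussian weight `exp (-s² / 2)` as `ℙ[V > s² / 2]` and exchange the integrals. For
fixed `v` the region is `|s| < √(2v)`, where the fundamental theorem of calculus for Lipschitz
functions integrates the derivative. -/
lemma integral_deriv_gaussianReal_eq {g : ℝ → ℝ} {C : NNReal} (hg : LipschitzWith C g) {η : ℝ}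
    (hη : 0 < η) :
    ∫ t, deriv g (η * t) ∂(gaussianReal 0 1) =
      1 / (η * √(2 * Real.pi)) *
        ∫ v, (g (η * √(2 * v)) - g (-(η * √(2 * v)))) ∂(expMeasure 1) := by
  set Φ : ℝ → ℝ → ℝ := fun s v => (Set.Ioi (s ^ 2 / 2)).indicator (fun _ => deriv g (η * s)) v
    with hΦ
  have hder : Measurable fun s => deriv g (η * s) := (measurable_deriv g).comp (by fun_prop)
  have hΦm : Measurable (Function.uncurry Φ) := by
    have : Function.uncurry Φ =
        {p : ℝ × ℝ | p.1 ^ 2 / 2 < p.2}.indicator fun p => deriv g (η * p.1) := by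
      ext p
      simp [Function.uncurry, hΦ, Set.indicator]
    rw [this]
    exact (hder.comp measurable_fst).indicator
      (measurableSet_lt (by fun_prop) (by fun_prop))
  have hbd : ∀ s, ‖deriv g (η * s)‖ ≤ C := fun s => norm_deriv_le_of_lipschitz hg
  have htail : ∀ s : ℝ, (expMeasure 1).real (Set.Ioi (s ^ 2 / 2)) = Real.exp (-(1 / 2) * s ^ 2) :=
    fun s => by
    rw [measureReal_def, expMeasure_one_Ioi (by positivity),
      ENNReal.toReal_ofReal (Real.exp_pos _).le]
    congr 1
    ring
  have hint : Integrable (Function.uncurry Φ) (volume.prod (expMeasure 1)) := by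
    rw [integrable_prod_iff hΦm.aestronglyMeasurable]
    refine ⟨Filter.Eventually.of_forall fun s => ?_, ?_⟩
    · exact (integrable_const (deriv g (η * s))).indicator (s := Set.Ioi (s ^ 2 / 2)) measurableSet_Ioi
    · have : ∀ s, ∫ v, ‖Function.uncurry Φ (s, v)‖ ∂(expMeasure 1) =
          Real.exp (-(1 / 2) * s ^ 2) * ‖deriv g (η * s)‖ := fun s => by
        simp only [Function.uncurry, hΦ, norm_indicator_eq_indicator_norm]
        rw [integral_indicator_const _ measurableSet_Ioi, htail, smul_eq_mul]
      simp_rw [this]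
      have hexp := (integrable_exp_neg_mul_sq (b := 1 / 2) (by norm_num)).mul_const (C : ℝ)
      refine hexp.mono' (by fun_prop) (Filter.Eventually.of_forall fun s => ?_)
      rw [norm_mul, norm_norm, Real.norm_eq_abs, abs_of_pos (Real.exp_pos _)]
      exact mul_le_mul_of_nonneg_left (hbd s) (Real.exp_pos _).le
  have hleft : ∀ s, ∫ v, Φ s v ∂(expMeasure 1) =
      Real.exp (-(1 / 2) * s ^ 2) * deriv g (η * s) := fun s => by
    simp only [hΦ]
    rw [integral_indicator_const _ measurableSet_Ioi, htail, smul_eq_mul]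
  -- This holds for negative `v` as well: the square root is then `0` and the region of integration
  -- is empty.
  have hright : ∀ v, g (η * √(2 * v)) - g (-(η * √(2 * v))) = η * ∫ s, Φ s v := fun v => by
    have hac := (hg.lipschitzOnWith (s := Set.uIcc (η * -√(2 * v)) (η * √(2 * v))))
      |>.absolutelyContinuousOnInterval.integral_deriv_eq_sub
    rw [← mul_neg, ← hac, ← intervalIntegral.mul_integral_comp_mul_left,
      intervalIntegral.integral_of_le (by linarith [Real.sqrt_nonneg (2 * v)]),
      integral_Ioc_eq_integral_Ioo, ← integral_indicator measurableSet_Ioo]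
    congr 2
    ext s
    simp only [hΦ, Set.indicator, Set.mem_Ioo, Set.mem_Ioi]
    have : (-√(2 * v) < s ∧ s < √(2 * v)) ↔ s ^ 2 / 2 < v := by
      rw [← abs_lt, Real.lt_sqrt (abs_nonneg _), sq_abs, div_lt_iff₀' two_pos]
    simp only [this]
  simp_rw [hright]
  rw [integral_const_mul, ← integral_integral_swap hint]
  simp_rw [hleft]
  rw [integral_gaussianReal_eq_integral_smul one_ne_zero, ← mul_assoc]
  have : 1 / (η * √(2 * Real.pi)) * η = (√(2 * Real.pi))⁻¹ := by field_simp
  rw [this, ← integral_const_mul]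
  refine integral_congr_ae (Filter.Eventually.of_forall fun s => ?_)
  simp only [gaussianPDFReal_def, smul_eq_mul, NNReal.coe_one, mul_one, sub_zero]
  rw [mul_assoc]
  congr 3
  ring

/-! ### The gradient of the smoothed function -/

section Gradient

variable {n : ℕ} {η : ℝ} {f : Vec n → ℝ} {C : NNReal}

instance (n : ℕ) (η : ℝ) : IsProbabilityMeasure (gaussianLaw n η) :=
  Measure.isProbabilityMeasure_map (by fun_prop)

lemma integral_gaussianLaw (h : Vec n → ℝ) (hη : 0 < η) :
    ∫ z, h z ∂(gaussianLaw n η) = ∫ z, h (η • z) ∂(stdGaussian (Vec n)) :=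
  (measurableEmbedding_const_smul₀ hη.ne').integral_map h

lemma shiftPlus_sub_shiftMinus (η : ℝ) (x : Vec n) (v : ℝ) (z : Vec n) (i : Fin n) :
    shiftPlus η x v z i - shiftMinus η x v z i = EuclideanSpace.single i (2 * (η * √(2 * v))) := by
  ext j
  by_cases h : j = i
  · simp [shiftPlus, shiftMinus, h]; ring
  · simp [shiftPlus, shiftMinus, h]

lemma norm_shiftPlus_sub_shiftMinus (hη : 0 < η) (x : Vec n) (v : ℝ) (z : Vec n) (i : Fin n) :
    ‖shiftPlus η x v z i - shiftMinus η x v z i‖ = 2 * (η * √(2 * v)) := by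
  rw [shiftPlus_sub_shiftMinus, PiLp.norm_single, Real.norm_eq_abs,
    abs_of_nonneg (by positivity)]

lemma shiftPlus_sub_shiftPlus (η : ℝ) (x y : Vec n) (v : ℝ) (z : Vec n) (i : Fin n) :
    shiftPlus η x v z i - shiftPlus η y v z i = x - y := by
  ext j
  by_cases h : j = i <;> simp [shiftPlus, h]

lemma shiftMinus_sub_shiftMinus (η : ℝ) (x y : Vec n) (v : ℝ) (z : Vec n) (i : Fin n) :
    shiftMinus η x v z i - shiftMinus η y v z i = x - y := by
  ext j
  by_cases h : j = i <;> simp [shiftMinus, h]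

lemma continuous_shiftPlus (η : ℝ) (i : Fin n) :
    Continuous fun p : Vec n × ℝ × Vec n => shiftPlus η p.1 p.2.1 p.2.2 i := by
  refine (PiLp.continuous_toLp 2 _).comp (continuous_pi fun j => ?_)
  by_cases h : j = i
  · simp only [h, if_true]; fun_prop
  · simp only [h, if_false]; fun_prop

lemma continuous_shiftMinus (η : ℝ) (i : Fin n) :
    Continuous fun p : Vec n × ℝ × Vec n => shiftMinus η p.1 p.2.1 p.2.2 i := by
  refine (PiLp.continuous_toLp 2 _).comp (continuous_pi fun j => ?_)
  by_cases h : j = i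
  · simp only [h, if_true]; fun_prop
  · simp only [h, if_false]; fun_prop

lemma lintegral_sq_sqrt_expMeasure_le :
    ∫⁻ v, ENNReal.ofReal (√(2 * v) ^ 2) ∂(expMeasure 1) ≤ ENNReal.ofReal 2 := by
  have : ∀ v : ℝ, ENNReal.ofReal (√(2 * v) ^ 2) = ENNReal.ofReal 2 * ENNReal.ofReal v := fun v => by
    rw [← ENNReal.ofReal_mul (by norm_num)]
    rcases le_total 0 v with h | h
    · rw [Real.sq_sqrt (by positivity)]
    · rw [Real.sqrt_eq_zero_of_nonpos (by linarith), ENNReal.ofReal_of_nonpos (p := 2 * v)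
        (by linarith)]
      simp
  simp_rw [this]
  rw [lintegral_const_mul _ (by fun_prop)]
  exact (mul_le_mul_right lintegral_ofReal_expMeasure_one_le _).trans (by simp)

lemma integrable_sqrt_expMeasure : Integrable (fun v => √(2 * v)) (expMeasure 1) := by
  have h : MemLp (fun v => √(2 * v)) 2 (expMeasure 1) := by
    refine ⟨by fun_prop, ((eLpNorm_two_le_iff (c := √2) (by positivity)).2 ?_).trans_lt
      ENNReal.ofReal_lt_top⟩
    rw [Real.sq_sqrt (by norm_num)]
    exact lintegral_sq_sqrt_expMeasure_le
  exact h.integrable one_le_two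

lemma abs_sub_shift_le (hf : LipschitzWith C f) (hη : 0 < η) (x : Vec n) (v : ℝ) (z : Vec n)
    (i : Fin n) :
    |f (shiftPlus η x v z i) - f (shiftMinus η x v z i)| ≤ C * (2 * (η * √(2 * v))) := by
  have := hf.dist_le_mul (shiftPlus η x v z i) (shiftMinus η x v z i)
  rwa [Real.dist_eq, dist_eq_norm, norm_shiftPlus_sub_shiftMinus hη] at this

lemma integrable_sub_shift (hf : LipschitzWith C f) (hη : 0 < η) (x : Vec n) (i : Fin n) :
    Integrable (fun p : ℝ × Vec n => f (shiftPlus η x p.1 p.2 i) - f (shiftMinus η x p.1 p.2 i))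
      ((expMeasure 1).prod (gaussianLaw n η)) := by
  have h1 : Integrable (fun p : ℝ × Vec n => C * (2 * (η * √(2 * p.1))))
      ((expMeasure 1).prod (gaussianLaw n η)) :=
    (((integrable_sqrt_expMeasure.comp_fst (gaussianLaw n η)).const_mul η).const_mul 2).const_mul _
  refine h1.mono' ?_ (Filter.Eventually.of_forall fun p => abs_sub_shift_le hf hη x p.1 p.2 i)
  have hc : Continuous fun p : ℝ × Vec n => (x, p) := by fun_prop
  exact ((hf.continuous.comp ((continuous_shiftPlus η i).comp hc)).sub
    (hf.continuous.comp ((continuous_shiftMinus η i).comp hc))).aestronglyMeasurable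

lemma integrable_comp_sub_smul (hf : LipschitzWith C f) (x : Vec n) :
    Integrable (fun z => f (x - η • z)) (stdGaussian (Vec n)) := by
  have h1 : Integrable (fun z : Vec n => |f x| + C * (|η| * ‖z‖)) (stdGaussian (Vec n)) :=
    (integrable_const _).add (((integrable_norm_stdGaussian n).const_mul _).const_mul _)
  have hc := hf.continuous
  refine h1.mono' (by fun_prop) (Filter.Eventually.of_forall fun z => ?_)
  have := hf.dist_le_mul (x - η • z) x
  rw [Real.dist_eq, dist_eq_norm, sub_sub_cancel_left, norm_neg, norm_smul, Real.norm_eq_abs] at this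
  rw [Real.norm_eq_abs]
  calc |f (x - η • z)| = |f x + (f (x - η • z) - f x)| := by congr 1; ring
    _ ≤ _ := (abs_add_le _ _).trans (by gcongr)

/-- Differentiation under the integral needs `f` to be differentiable only at almost every `x - η •
z`, which Rademacher's theorem supplies; the Lipschitz constant is the dominating function. -/
lemma hasFDerivAt_smoothed (hf : LipschitzWith C f) (hη : 0 < η) (x : Vec n) :
    Integrable (fun z => fderiv ℝ f (x - η • z)) (stdGaussian (Vec n)) ∧
    HasFDerivAt (smoothed η f) (∫ z, fderiv ℝ f (x - η • z) ∂(stdGaussian (Vec n))) x := by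
  have h1 : smoothed η f = fun x => ∫ z, f (x - η • z) ∂(stdGaussian (Vec n)) :=
    funext fun x => smoothed_eq_integral hη f x
  have hc := hf.continuous
  rw [h1]
  refine hasFDerivAt_integral_of_dominated_loc_of_lip (F := fun x z => f (x - η • z))
    (bound := fun _ => (C : ℝ)) (s := Set.univ)
    Filter.univ_mem (Filter.Eventually.of_forall fun y => ?_) (integrable_comp_sub_smul hf x)
    ?_ (Filter.Eventually.of_forall fun z => ?_) (integrable_const _) ?_
  · exact Continuous.aestronglyMeasurable (by fun_prop)
  · exact ((measurable_fderiv ℝ f).comp (by fun_prop)).aestronglyMeasurable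
  · have : LipschitzWith (C * 1) (fun y => f (y - η • z)) :=
      hf.comp (LipschitzWith.of_dist_le_mul fun a b => by simp)
    rw [lipschitzOnWith_univ]
    simpa using this
  · have := ae_stdGaussian_of_ae_volume hη x hf.ae_differentiableAt
    filter_upwards [this] with z hz
    exact (hasFDerivAt_comp_sub (η • z)).2 hz.hasFDerivAt

/-- Resample coordinate `i` and apply the one-dimensional identity to the restriction of `f` to a
line. Line derivatives suit this because they are derivatives of that restriction at every point,
whether or not `f` is differentiable there. -/
lemma integral_lineDeriv_single (hf : LipschitzWith C f) (hη : 0 < η) (x : Vec n) (i : Fin n)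
    (hi : Integrable (fun z => lineDeriv ℝ f (x - η • z) (EuclideanSpace.single i 1))
      (stdGaussian (Vec n))) :
    ∫ z, lineDeriv ℝ f (x - η • z) (EuclideanSpace.single i 1) ∂(stdGaussian (Vec n)) =
      1 / (η * √(2 * Real.pi)) * ∫ p : ℝ × Vec n,
        (f (shiftPlus η x p.1 p.2 i) - f (shiftMinus η x p.1 p.2 i))
          ∂((expMeasure 1).prod (gaussianLaw n η)) := by
  have hu := measurable_toLp_update i
  set U : Vec n × ℝ → Vec n := fun p => WithLp.toLp 2 (Function.update (WithLp.ofLp p.1) i p.2)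
    with hU
  have hmap := map_update_stdGaussian i
  have hLm : Measurable fun z => lineDeriv ℝ f (x - η • z) (EuclideanSpace.single i 1) :=
    (measurable_lineDeriv hf.continuous).comp (by fun_prop)
  rw [integral_prod_symm _ (integrable_sub_shift hf hη x i),
    integral_gaussianLaw (fun z => ∫ v, (f (shiftPlus η x v z i) - f (shiftMinus η x v z i))
      ∂(expMeasure 1)) hη, ← integral_const_mul]
  have hi2 := hi
  rw [← hmap] at hi2
  have hi3 := hi2.comp_measurable hu
  conv_lhs => rw [← hmap]
  rw [integral_map hu.aemeasurable hLm.aestronglyMeasurable]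
  refine (integral_prod _ hi3).trans ?_
  refine integral_congr_ae (Filter.Eventually.of_forall fun z => ?_)
  set g : ℝ → ℝ := fun r => f (WithLp.toLp 2 fun j => if j = i then x j + r else x j - η * z j)
    with hg
  have hgl : LipschitzWith (C * 1) g := by
    refine hf.comp (LipschitzWith.of_dist_le_mul fun a b => ?_)
    have : (WithLp.toLp 2 (fun j => if j = i then x j + a else x j - η * z j) : Vec n) -
        WithLp.toLp 2 (fun j => if j = i then x j + b else x j - η * z j) =
        EuclideanSpace.single i (a - b) := by
      ext j
      by_cases h : j = i <;> simp [h]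
    rw [dist_eq_norm, this, PiLp.norm_single, Real.dist_eq, Real.norm_eq_abs]
    simp
  have hder : ∀ t, lineDeriv ℝ f (x - η • U (z, t)) (EuclideanSpace.single i 1) =
      deriv g (η * -t) := fun t => by
    have h1 : (fun τ : ℝ => f (x - η • U (z, t) + τ • EuclideanSpace.single i 1)) =
        fun τ => g (η * -t + τ) := by
      ext τ
      simp only [hg, hU]
      congr 1
      ext j
      by_cases h : j = i
      · subst h; simp; ring
      · simp [h]
    rw [lineDeriv, h1, deriv_comp_const_add, add_zero]
  have hstein := integral_deriv_gaussianReal_eq hgl hη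
  -- Smoothing evaluates `f` at `x - η • z`; the symmetry of the Gaussian removes the sign.
  have hneg : ∫ t, deriv g (η * -t) ∂(gaussianReal 0 1) =
      ∫ t, deriv g (η * t) ∂(gaussianReal 0 1) := by
    have h1 := gaussianReal_map_neg (μ := 0) (v := 1)
    rw [neg_zero] at h1
    conv_rhs => rw [← h1]
    have hm : Measurable fun t => deriv g (η * t) := (measurable_deriv g).comp (by fun_prop)
    rw [integral_map (by fun_prop) hm.aestronglyMeasurable]
  refine (integral_congr_ae (Filter.Eventually.of_forall hder)).trans ?_
  rw [hneg, hstein]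
  congr 1

/-- The gradient of the smoothed function, as a mean of symmetric differences. -/
lemma hasGradientAt_smoothed (hf : LipschitzWith C f) (hη : 0 < η) (x : Vec n) :
    HasGradientAt (smoothed η f) (WithLp.toLp 2 fun i => 1 / (η * √(2 * Real.pi)) *
      ∫ p : ℝ × Vec n, (f (shiftPlus η x p.1 p.2 i) - f (shiftMinus η x p.1 p.2 i))
          ∂((expMeasure 1).prod (gaussianLaw n η))) x := by
  obtain ⟨h1, h2⟩ := hasFDerivAt_smoothed hf hη x
  have h3 := h2.hasGradientAt
  convert! h3 using 1
  have hae := ae_stdGaussian_of_ae_volume hη x hf.ae_differentiableAt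
  ext i
  have h4 : ∀ L : Vec n →L[ℝ] ℝ, ((InnerProductSpace.toDual ℝ (Vec n)).symm L) i =
      L (EuclideanSpace.single i 1) := fun L => by
    have := InnerProductSpace.toDual_symm_apply (x := EuclideanSpace.single i (1 : ℝ)) (y := L)
    rw [← this, EuclideanSpace.inner_single_right]
    simp
  have h5 : (fun z => fderiv ℝ f (x - η • z) (EuclideanSpace.single i 1)) =ᵐ[stdGaussian (Vec n)]
      fun z => lineDeriv ℝ f (x - η • z) (EuclideanSpace.single i 1) := by
    filter_upwards [hae] with z hz
    exact hz.lineDeriv_eq_fderiv.symm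
  rw [h4, ContinuousLinearMap.integral_apply h1, integral_congr_ae h5,
    integral_lineDeriv_single hf hη x i ((h1.apply_continuousLinearMap _).congr h5)]

lemma gradient_smoothed_apply (hf : LipschitzWith C f) (hη : 0 < η) (x : Vec n) (i : Fin n) :
    gradient (smoothed η f) x i = 1 / (η * √(2 * Real.pi)) *
      ∫ p : ℝ × Vec n, (f (shiftPlus η x p.1 p.2 i) - f (shiftMinus η x p.1 p.2 i))
          ∂((expMeasure 1).prod (gaussianLaw n η)) := by
  rw [(hasGradientAt_smoothed hf hη x).gradient]

lemma differentiable_smoothed (hf : LipschitzWith C f) (hη : 0 < η) :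
    Differentiable ℝ (smoothed η f) :=
  fun x => (hasFDerivAt_smoothed hf hη x).2.differentiableAt

/-- The smoothness constant `L₀ √n √(2/π) / η` of `f_η`. -/
def smoothness (n : ℕ) (C η : ℝ) : ℝ := √n * (2 * C / (η * √(2 * Real.pi)))

lemma norm_le_sqrt_mul_of_forall_abs_le (y : Vec n) {c : ℝ} (hc : 0 ≤ c) (h : ∀ i, |y i| ≤ c) :
    ‖y‖ ≤ √n * c := by
  rw [EuclideanSpace.norm_eq, ← Real.sqrt_sq hc, ← Real.sqrt_mul (by positivity)]
  refine Real.sqrt_le_sqrt ?_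
  calc ∑ i, ‖y i‖ ^ 2 ≤ ∑ _i : Fin n, c ^ 2 :=
        Finset.sum_le_sum fun i _ => by gcongr; exact h i
    _ = _ := by simp

/-- In the symmetric-difference formula the shifted points of `x` and `y` still differ by `x - y`.
Each component therefore changes by at most `2C‖x - y‖ / (η√(2π))`, and the `n` components
contribute `√n`. -/
lemma norm_gradient_smoothed_sub_le (hf : LipschitzWith C f) (hη : 0 < η) (x y : Vec n) :
    ‖gradient (smoothed η f) x - gradient (smoothed η f) y‖ ≤ smoothness n C η * ‖x - y‖ := by
  rw [smoothness, mul_assoc]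
  refine norm_le_sqrt_mul_of_forall_abs_le _ (by positivity) fun i => ?_
  rw [PiLp.sub_apply, gradient_smoothed_apply hf hη, gradient_smoothed_apply hf hη, ← mul_sub,
    ← integral_sub (integrable_sub_shift hf hη x i) (integrable_sub_shift hf hη y i), abs_mul,
    abs_of_nonneg (by positivity)]
  have h1 : ∀ a b : Vec n, |f a - f b| ≤ C * ‖a - b‖ := fun a b => by
    have := hf.dist_le_mul a b
    rwa [Real.dist_eq, dist_eq_norm] at this
  have h2 : |∫ p : ℝ × Vec n, (f (shiftPlus η x p.1 p.2 i) - f (shiftMinus η x p.1 p.2 i) -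
      (f (shiftPlus η y p.1 p.2 i) - f (shiftMinus η y p.1 p.2 i)))
        ∂((expMeasure 1).prod (gaussianLaw n η))| ≤ 2 * (C * ‖x - y‖) := by
    have h3 := norm_integral_le_of_norm_le_const (C := 2 * (C * ‖x - y‖))
      (μ := (expMeasure 1).prod (gaussianLaw n η))
      (f := fun p : ℝ × Vec n => f (shiftPlus η x p.1 p.2 i) - f (shiftMinus η x p.1 p.2 i) -
        (f (shiftPlus η y p.1 p.2 i) - f (shiftMinus η y p.1 p.2 i)))
      (Filter.Eventually.of_forall fun p => ?_)
    · simpa using h3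
    · have ha := h1 (shiftPlus η x p.1 p.2 i) (shiftPlus η y p.1 p.2 i)
      have hb := h1 (shiftMinus η x p.1 p.2 i) (shiftMinus η y p.1 p.2 i)
      rw [shiftPlus_sub_shiftPlus] at ha
      rw [shiftMinus_sub_shiftMinus] at hb
      rw [Real.norm_eq_abs]
      rw [abs_le] at *
      constructor <;> linarith [ha.1, ha.2, hb.1, hb.2]
  calc 1 / (η * √(2 * Real.pi)) * _ ≤ 1 / (η * √(2 * Real.pi)) * (2 * (C * ‖x - y‖)) := by gcongr
    _ = _ := by ring

end Gradient

/-! ### Smoothing error and descent -/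

section Smoothed

variable {n : ℕ} {η : ℝ} {f : Vec n → ℝ} {C : NNReal}

lemma abs_smoothed_sub_le (hf : LipschitzWith C f) {η₁ η₂ : ℝ} (h₁ : 0 < η₁) (h₂ : 0 < η₂)
    (x : Vec n) : |smoothed η₁ f x - smoothed η₂ f x| ≤ C * √n * |η₁ - η₂| := by
  rw [smoothed_eq_integral h₁, smoothed_eq_integral h₂,
    ← integral_sub (integrable_comp_sub_smul hf x) (integrable_comp_sub_smul hf x)]
  have hi := (integrable_norm_stdGaussian n).const_mul (C * |η₁ - η₂|)
  rw [← Real.norm_eq_abs]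
  refine (norm_integral_le_of_norm_le hi (Filter.Eventually.of_forall fun z => ?_)).trans ?_
  · have := hf.dist_le_mul (x - η₁ • z) (x - η₂ • z)
    rw [dist_eq_norm, dist_eq_norm, sub_sub_sub_cancel_left, ← sub_smul, norm_smul,
      Real.norm_eq_abs (η₂ - η₁), abs_sub_comm, ← mul_assoc] at this
    exact this
  · rw [integral_const_mul]
    calc C * |η₁ - η₂| * ∫ z : Vec n, ‖z‖ ∂(stdGaussian (Vec n)) ≤ C * |η₁ - η₂| * √n := by
          gcongr; exact integral_norm_stdGaussian_le n
      _ = _ := by ring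

lemma smoothed_le_add (hf : LipschitzWith C f) (hη : 0 < η) (x : Vec n) :
    smoothed η f x ≤ f x + C * √n * η := by
  rw [smoothed_eq_integral hη]
  have hi := ((integrable_norm_stdGaussian n).const_mul (C * η))
  have hi2 := (integrable_const (μ := stdGaussian (Vec n)) (f x)).add hi
  calc ∫ z, f (x - η • z) ∂(stdGaussian (Vec n))
      ≤ ∫ z : Vec n, (f x + C * η * ‖z‖) ∂(stdGaussian (Vec n)) := by
        refine integral_mono (integrable_comp_sub_smul hf x) hi2 fun z => ?_
        have := hf.dist_le_mul (x - η • z) x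
        rw [Real.dist_eq, dist_eq_norm, sub_sub_cancel_left, norm_neg, norm_smul, Real.norm_eq_abs,
          abs_of_pos hη, ← mul_assoc] at this
        simp only
        linarith [(abs_le.1 this).2]
    _ = f x + C * η * ∫ z : Vec n, ‖z‖ ∂(stdGaussian (Vec n)) := by
        rw [integral_add (integrable_const _) hi, integral_const_mul]
        simp
    _ ≤ f x + C * η * √n := by gcongr; exact integral_norm_stdGaussian_le n
    _ = _ := by ring

lemma iInf_le_smoothed (hf : LipschitzWith C f) (hb : BddBelow (Set.range f)) (hη : 0 < η)
    (x : Vec n) : ⨅ y, f y ≤ smoothed η f x := by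
  rw [smoothed_eq_integral hη]
  have := integral_mono (μ := stdGaussian (Vec n)) (integrable_const (⨅ y, f y))
    (integrable_comp_sub_smul (η := η) hf x) fun z => ciInf_le hb (x - η • z)
  simpa using this

lemma lipschitzWith_smoothed (hf : LipschitzWith C f) (hη : 0 < η) :
    LipschitzWith C (smoothed η f) := by
  refine LipschitzWith.of_dist_le_mul fun x y => ?_
  rw [dist_eq_norm, smoothed_eq_integral hη, smoothed_eq_integral hη,
    ← integral_sub (integrable_comp_sub_smul hf x) (integrable_comp_sub_smul hf y)]
  refine (norm_integral_le_of_norm_le_const (C := C * dist x y)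
    (Filter.Eventually.of_forall fun z => ?_)).trans (by simp)
  have := hf.dist_le_mul (x - η • z) (y - η • z)
  rwa [dist_sub_right, dist_eq_norm] at this

lemma norm_gradient_smoothed_le (hf : LipschitzWith C f) (hη : 0 < η) (x : Vec n) :
    ‖gradient (smoothed η f) x‖ ≤ C := by
  rw [gradient, LinearIsometryEquiv.norm_map]
  exact norm_fderiv_le_of_lipschitz ℝ (lipschitzWith_smoothed hf hη)

lemma smoothness_nonneg (hη : 0 < η) : 0 ≤ smoothness n C η := by
  unfold smoothness
  positivity

lemma continuous_gradient_smoothed (hf : LipschitzWith C f) (hη : 0 < η) :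
    Continuous (gradient (smoothed η f)) := by
  have : LipschitzWith (smoothness n C η).toNNReal (gradient (smoothed η f)) :=
    LipschitzWith.of_dist_le_mul fun x y => by
      rw [dist_eq_norm, dist_eq_norm, Real.coe_toNNReal _ (smoothness_nonneg hη)]
      exact norm_gradient_smoothed_sub_le hf hη x y
  exact this.continuous

/-- The descent lemma. -/
lemma le_add_inner_add_of_lipschitz_gradient {E : Type*} [NormedAddCommGroup E]
    [InnerProductSpace ℝ E] [CompleteSpace E] {F : E → ℝ} {L : ℝ} (hF : Differentiable ℝ F)
    (hL : ∀ x y, ‖gradient F x - gradient F y‖ ≤ L * ‖x - y‖) (x d : E) :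
    F (x + d) ≤ F x + inner ℝ (gradient F x) d + L / 2 * ‖d‖ ^ 2 := by
  -- The function minus its quadratic model along the segment; the claim is `h 1 ≤ h 0`.
  set h : ℝ → ℝ := fun t => F (x + t • d) - t * inner ℝ (gradient F x) d - L / 2 * ‖d‖ ^ 2 * t ^ 2
    with hh
  have hd : ∀ t, HasDerivAt h (inner ℝ (gradient F (x + t • d)) d - 1 * inner ℝ (gradient F x) d -
      L / 2 * ‖d‖ ^ 2 * (2 * t)) t := fun t => by
    have h1 : HasDerivAt (fun t : ℝ => x + t • d) d t := by
      simpa using ((hasDerivAt_id t).smul_const d).const_add x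
    have h2 := (hF (x + t • d)).hasGradientAt.hasFDerivAt.comp_hasDerivAt t h1
    rw [InnerProductSpace.toDual_apply_apply] at h2
    have h3 := ((hasDerivAt_id t).mul_const (inner ℝ (gradient F x) d))
    have h4 := (hasDerivAt_pow 2 t).const_mul (L / 2 * ‖d‖ ^ 2)
    have h5 : HasDerivAt h _ t := (h2.sub h3).sub h4
    exact h5.congr_deriv (by norm_num)
  have hanti : AntitoneOn h (Set.Icc 0 1) := by
    refine antitoneOn_of_deriv_nonpos (convex_Icc 0 1)
      (fun t _ => (hd t).continuousAt.continuousWithinAt)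
      (fun t _ => (hd t).differentiableAt.differentiableWithinAt) fun t ht => ?_
    rw [interior_Icc] at ht
    rw [(hd t).deriv, one_mul, ← inner_sub_left]
    have h1 := (real_inner_le_norm (gradient F (x + t • d) - gradient F x) d).trans
      (mul_le_mul_of_nonneg_right (hL (x + t • d) x) (norm_nonneg d))
    rw [add_sub_cancel_left, norm_smul, Real.norm_eq_abs, abs_of_pos ht.1] at h1
    linarith
  have := hanti (Set.left_mem_Icc.2 zero_le_one) (Set.right_mem_Icc.2 zero_le_one) zero_le_one
  simp only [hh] at this
  simp only [one_smul, zero_smul, add_zero] at this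
  linarith

end Smoothed

/-! ### Moments of the estimator -/

section Estimator

variable {n : ℕ} {S : Type u} [MeasurableSpace S] {Q : Measure S} {G : Vec n → S → ℝ}
  {f : Vec n → ℝ} {L₀ η : ℝ}

/-- A difference of means is bounded by the `L¹` norm, which a probability measure bounds by the
`L²` norm. -/
lemma DecisionIndependent.lipschitzWith (h : DecisionIndependent Q G f L₀) (hL : 0 ≤ L₀) :
    LipschitzWith L₀.toNNReal f := by
  have := h.isProbability
  refine LipschitzWith.of_dist_le_mul fun x y => ?_
  have hm : AEStronglyMeasurable (fun s => G x s - G y s) Q :=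
    ((h.integrable x).sub (h.integrable y)).aestronglyMeasurable
  rw [dist_eq_norm, dist_eq_norm, h.objective, h.objective,
    ← integral_sub (h.integrable x) (h.integrable y), Real.coe_toNNReal _ hL]
  have h1 : eLpNorm (fun s => G x s - G y s) 1 Q ≤ ENNReal.ofReal (L₀ * ‖x - y‖) :=
    (eLpNorm_le_eLpNorm_of_exponent_le one_le_two hm).trans (h.lipschitz x y)
  have h2 := (enorm_integral_le_lintegral_enorm (μ := Q) (fun s => G x s - G y s)).trans
    ((eLpNorm_one_eq_lintegral_enorm (f := fun s => G x s - G y s) (μ := Q)).symm.le.trans h1)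
  rw [← ofReal_norm] at h2
  exact (ENNReal.ofReal_le_ofReal_iff (by positivity)).1 h2

/-- The joint law of the noise `(V_k, Z_k, ξ_k)`. -/
abbrev noiseLaw (n : ℕ) (η : ℝ) {S : Type*} [MeasurableSpace S] (Q : Measure S) :
    Measure (ℝ × Vec n × S) :=
  (expMeasure 1).prod ((gaussianLaw n η).prod Q)

lemma measurable_estimator (hG : Measurable (Function.uncurry G)) (η : ℝ) :
    Measurable fun p : Vec n × ℝ × Vec n × S => estimator G η p.1 p.2.1 p.2.2.1 p.2.2.2 := by
  refine (PiLp.volume_preserving_toLp (Fin n)).measurable.comp (measurable_pi_lambda _ fun i => ?_)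
  have hp : Measurable fun p : Vec n × ℝ × Vec n × S => (p.1, p.2.1, p.2.2.1) := by fun_prop
  have hs : Measurable fun p : Vec n × ℝ × Vec n × S => p.2.2.2 := by fun_prop
  exact ((hG.comp (((continuous_shiftPlus η i).measurable.comp hp).prodMk hs)).sub
    (hG.comp (((continuous_shiftMinus η i).measurable.comp hp).prodMk hs))).const_mul _

lemma measurable_estimator_apply (hG : Measurable (Function.uncurry G)) (η : ℝ) (x : Vec n) :
    Measurable fun p : ℝ × Vec n × S => estimator G η x p.1 p.2.1 p.2.2 :=
  (measurable_estimator hG η).comp measurable_prodMk_left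

/-- For fixed `v ≥ 0` the mean-square Lipschitz bound gives `L₀² (2η√(2v))² / (2πη²) = 4 L₀² v / π`:
the smoothing parameter cancels, and `V` has mean at most one. -/
lemma DecisionIndependent.lintegral_estimator_sq_apply_le (h : DecisionIndependent Q G f L₀)
    (hL : 0 ≤ L₀) (hη : 0 < η) (x : Vec n) (i : Fin n) :
    ∫⁻ p, ENNReal.ofReal (estimator G η x p.1 p.2.1 p.2.2 i ^ 2) ∂(noiseLaw n η Q) ≤
      ENNReal.ofReal (4 * L₀ ^ 2 / Real.pi) := by
  have := h.isProbability
  have hm : Measurable fun p : ℝ × Vec n × S => estimator G η x p.1 p.2.1 p.2.2 i :=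
    (by fun_prop : Measurable fun y : Vec n => y i).comp (measurable_estimator_apply h.measurable η x)
  rw [lintegral_prod _ (hm.pow_const 2).ennreal_ofReal.aemeasurable]
  have h1 : ∀ v, ∫⁻ q : Vec n × S, ENNReal.ofReal (estimator G η x v q.1 q.2 i ^ 2)
      ∂((gaussianLaw n η).prod Q) ≤
      ENNReal.ofReal (2 * L₀ ^ 2 / Real.pi) * ENNReal.ofReal (√(2 * v) ^ 2) := fun v => by
    have hmv : Measurable fun q : Vec n × S => estimator G η x v q.1 q.2 i :=
      hm.comp measurable_prodMk_left
    rw [lintegral_prod _ (hmv.pow_const 2).ennreal_ofReal.aemeasurable]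
    have h2 : ∀ z, ∫⁻ s, ENNReal.ofReal (estimator G η x v z s i ^ 2) ∂Q ≤
        ENNReal.ofReal (2 * L₀ ^ 2 / Real.pi) * ENNReal.ofReal (√(2 * v) ^ 2) := fun z => by
      have h3 := h.lipschitz (shiftPlus η x v z i) (shiftMinus η x v z i)
      rw [norm_shiftPlus_sub_shiftMinus hη, eLpNorm_two_le_iff (by positivity)] at h3
      have hG : ∀ a, Measurable (G a) := fun a => h.measurable.comp measurable_prodMk_left
      have h4 := hG (shiftPlus η x v z i)
      have h5 := hG (shiftMinus η x v z i)
      have h6 : ∀ s, ENNReal.ofReal (estimator G η x v z s i ^ 2) =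
          ENNReal.ofReal ((1 / (η * √(2 * Real.pi))) ^ 2) *
            ENNReal.ofReal ((G (shiftPlus η x v z i) s - G (shiftMinus η x v z i) s) ^ 2) :=
        fun s => by
          rw [← ENNReal.ofReal_mul (by positivity), ← mul_pow]
          rfl
      simp_rw [h6]
      rw [lintegral_const_mul _ (by fun_prop)]
      refine (mul_le_mul_right h3 _).trans (le_of_eq ?_)
      rw [← ENNReal.ofReal_mul (by positivity), ← ENNReal.ofReal_mul (by positivity)]
      congr 1
      rw [div_pow, mul_pow η, Real.sq_sqrt (by positivity)]
      field_simp
    refine (lintegral_mono h2).trans ?_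
    simp
  refine (lintegral_mono h1).trans ?_
  rw [lintegral_const_mul _ (by fun_prop)]
  refine (mul_le_mul_right lintegral_sq_sqrt_expMeasure_le _).trans (le_of_eq ?_)
  rw [← ENNReal.ofReal_mul (by positivity)]
  congr 1
  ring

lemma DecisionIndependent.lintegral_norm_estimator_sq_le (h : DecisionIndependent Q G f L₀)
    (hL : 0 ≤ L₀) (hη : 0 < η) (x : Vec n) :
    ∫⁻ p, ENNReal.ofReal (‖estimator G η x p.1 p.2.1 p.2.2‖ ^ 2) ∂(noiseLaw n η Q) ≤
      ENNReal.ofReal (4 * L₀ ^ 2 * n / Real.pi) := by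
  have hm : ∀ i, Measurable fun p : ℝ × Vec n × S => estimator G η x p.1 p.2.1 p.2.2 i := fun i =>
    (by fun_prop : Measurable fun y : Vec n => y i).comp (measurable_estimator_apply h.measurable η x)
  simp_rw [EuclideanSpace.real_norm_sq_eq, ENNReal.ofReal_sum_of_nonneg fun i _ => sq_nonneg _]
  rw [lintegral_finsetSum _ fun i _ => ((hm i).pow_const 2).ennreal_ofReal]
  refine (Finset.sum_le_sum fun i _ => h.lintegral_estimator_sq_apply_le hL hη x i).trans ?_
  rw [Finset.sum_const, Finset.card_univ, Fintype.card_fin, nsmul_eq_mul, ← ENNReal.ofReal_natCast,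
    ← ENNReal.ofReal_mul (by positivity)]
  refine ENNReal.ofReal_le_ofReal (le_of_eq ?_)
  ring

lemma DecisionIndependent.memLp_estimator (h : DecisionIndependent Q G f L₀)
    (hL : 0 ≤ L₀) (hη : 0 < η) (x : Vec n) :
    MemLp (fun p : ℝ × Vec n × S => estimator G η x p.1 p.2.1 p.2.2) 2 (noiseLaw n η Q) := by
  have hm := measurable_estimator_apply h.measurable η x
  refine (memLp_norm_iff hm.aestronglyMeasurable).1 ⟨hm.norm.aestronglyMeasurable, ?_⟩
  refine ((eLpNorm_two_le_iff (c := √(4 * L₀ ^ 2 * n / Real.pi)) (by positivity)).2 ?_).trans_lt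
    ENNReal.ofReal_lt_top
  rw [Real.sq_sqrt (by positivity)]
  exact h.lintegral_norm_estimator_sq_le hL hη x

/-- The estimator is an unbiased estimator of the gradient of the smoothed function. -/
lemma DecisionIndependent.integral_estimator (h : DecisionIndependent Q G f L₀)
    (hL : 0 ≤ L₀) (hη : 0 < η) (x : Vec n) :
    ∫ p, estimator G η x p.1 p.2.1 p.2.2 ∂(noiseLaw n η Q) = gradient (smoothed η f) x := by
  have := h.isProbability
  have hint := (h.memLp_estimator hL hη x).integrable one_le_two
  ext i
  have hi : Integrable (fun p : ℝ × Vec n × S => estimator G η x p.1 p.2.1 p.2.2 i)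
      (noiseLaw n η Q) := (EuclideanSpace.proj (𝕜 := ℝ) i).integrable_comp hint
  have h0 : (∫ p, estimator G η x p.1 p.2.1 p.2.2 ∂(noiseLaw n η Q)) i =
      ∫ p, estimator G η x p.1 p.2.1 p.2.2 i ∂(noiseLaw n η Q) :=
    ((EuclideanSpace.proj (𝕜 := ℝ) i).integral_comp_comm hint).symm
  rw [h0, gradient_smoothed_apply (h.lipschitzWith hL) hη]
  have hmp := measurePreserving_prodAssoc (expMeasure 1) (gaussianLaw n η) Q
  rw [← hmp.integral_comp MeasurableEquiv.prodAssoc.measurableEmbedding]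
  refine (integral_prod _ (hmp.integrable_comp_of_integrable hi)).trans ?_
  rw [← integral_const_mul]
  refine integral_congr_ae (Filter.Eventually.of_forall fun p => ?_)
  change ∫ s, 1 / (η * √(2 * Real.pi)) *
    (G (shiftPlus η x p.1 p.2 i) s - G (shiftMinus η x p.1 p.2 i) s) ∂Q = _
  rw [integral_const_mul, integral_sub (h.integrable _) (h.integrable _), ← h.objective,
    ← h.objective]

end Estimator

/-! ### The stochastic gradient scheme -/

section Scheme

variable {n : ℕ} {S : Type u} [MeasurableSpace S] {Q : Measure S} {G : Vec n → S → ℝ}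
  {f : Vec n → ℝ} {L₀ : ℝ} {γ η : ℕ → ℝ} {Ω : Type w} [MeasurableSpace Ω] {μ : Measure Ω}
  {V : ℕ → Ω → ℝ} {Z : ℕ → Ω → Vec n} {ξ : ℕ → Ω → S}

lemma IsNoise.measurable (hN : IsNoise μ Q η V Z ξ) (k : ℕ) :
    Measurable fun ω => (V k ω, Z k ω, ξ k ω) :=
  (hN.measurable_V k).prodMk ((hN.measurable_Z k).prodMk (hN.measurable_ξ k))

omit [MeasurableSpace Ω] in
-- The iterate `x_k` uses only the noise of the steps before `k`; in this form independence from the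
-- noise of step `k` follows from `iIndepFun`.
lemma exists_iterate_eq_comp (hG : Measurable (Function.uncurry G)) (γ η : ℕ → ℝ)
    (V : ℕ → Ω → ℝ) (Z : ℕ → Ω → Vec n) (ξ : ℕ → Ω → S) (x₀ : Vec n) (k : ℕ) :
    ∃ Φ : (Finset.range k → ℝ × Vec n × S) → Vec n, Measurable Φ ∧
      iterate G γ η V Z ξ x₀ k = fun ω => Φ fun i => (V i ω, Z i ω, ξ i ω) := by
  induction k with
  | zero => exact ⟨fun _ => x₀, measurable_const, rfl⟩
  | succ k ih =>
    obtain ⟨Φ, hΦ, h⟩ := ih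
    have hr : Measurable fun (t : Finset.range (k + 1) → ℝ × Vec n × S) (i : Finset.range k) =>
        t ⟨i, Finset.mem_range.2 ((Finset.mem_range.1 i.2).trans k.lt_succ_self)⟩ :=
      measurable_pi_lambda _ fun i => measurable_pi_apply _
    have hk : Measurable fun t : Finset.range (k + 1) → ℝ × Vec n × S =>
        t ⟨k, Finset.self_mem_range_succ k⟩ := measurable_pi_apply _
    refine ⟨_, (hΦ.comp hr).sub (((measurable_estimator hG (η k)).comp
      ((hΦ.comp hr).prodMk hk)).const_smul (γ k)), ?_⟩
    ext1 ω
    simp only [iterate, h]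
    rfl

lemma measurable_iterate (hG : Measurable (Function.uncurry G)) (hN : IsNoise μ Q η V Z ξ)
    (x₀ : Vec n) (k : ℕ) : Measurable (iterate G γ η V Z ξ x₀ k) := by
  obtain ⟨Φ, hΦ, h⟩ := exists_iterate_eq_comp hG γ η V Z ξ x₀ k
  rw [h]
  exact hΦ.comp (measurable_pi_lambda _ fun i => hN.measurable i)

lemma indepFun_iterate_noise (hG : Measurable (Function.uncurry G)) (hN : IsNoise μ Q η V Z ξ)
    (x₀ : Vec n) (k : ℕ) :
    IndepFun (iterate G γ η V Z ξ x₀ k) (fun ω => (V k ω, Z k ω, ξ k ω)) μ := by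
  obtain ⟨Φ, hΦ, h⟩ := exists_iterate_eq_comp hG γ η V Z ξ x₀ k
  have hd : Disjoint (Finset.range k) {k} := by simp
  have h1 := hN.indep.indepFun_finset (Finset.range k) {k} hd hN.measurable
  rw [h]
  exact h1.comp hΦ (measurable_pi_apply (⟨k, Finset.mem_singleton_self k⟩ : ({k} : Finset ℕ)))

lemma map_iterate_noise [IsProbabilityMeasure μ] (hG : Measurable (Function.uncurry G))
    (hN : IsNoise μ Q η V Z ξ) (x₀ : Vec n) (k : ℕ) :
    μ.map (fun ω => (iterate G γ η V Z ξ x₀ k ω, V k ω, Z k ω, ξ k ω)) =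
      (μ.map (iterate G γ η V Z ξ x₀ k)).prod (noiseLaw n (η k) Q) := by
  rw [noiseLaw, ← hN.law k]
  exact (indepFun_iff_map_prod_eq_prod_map_map (measurable_iterate hG hN x₀ k).aemeasurable
    (hN.measurable k).aemeasurable).1 (indepFun_iterate_noise hG hN x₀ k)

/-- The stochastic gradient used in step `k` of the scheme. -/
def stepDirection (G : Vec n → S → ℝ) (γ η : ℕ → ℝ) (V : ℕ → Ω → ℝ) (Z : ℕ → Ω → Vec n)
    (ξ : ℕ → Ω → S) (x₀ : Vec n) (k : ℕ) (ω : Ω) : Vec n :=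
  estimator G (η k) (iterate G γ η V Z ξ x₀ k ω) (V k ω) (Z k ω) (ξ k ω)

lemma measurable_iterate_prodMk_noise (hG : Measurable (Function.uncurry G))
    (hN : IsNoise μ Q η V Z ξ) (x₀ : Vec n) (k : ℕ) :
    Measurable fun ω => (iterate G γ η V Z ξ x₀ k ω, V k ω, Z k ω, ξ k ω) :=
  (measurable_iterate hG hN x₀ k).prodMk (hN.measurable k)

lemma measurable_stepDirection (hG : Measurable (Function.uncurry G)) (hN : IsNoise μ Q η V Z ξ)
    (x₀ : Vec n) (k : ℕ) : Measurable (stepDirection G γ η V Z ξ x₀ k) :=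
  (measurable_estimator hG (η k)).comp (measurable_iterate_prodMk_noise hG hN x₀ k)

variable [IsProbabilityMeasure μ]

lemma lintegral_norm_stepDirection_sq_le (h : DecisionIndependent Q G f L₀) (hL : 0 ≤ L₀)
    (hη : ∀ k, 0 < η k) (hN : IsNoise μ Q η V Z ξ) (x₀ : Vec n) (k : ℕ) :
    ∫⁻ ω, ENNReal.ofReal (‖stepDirection G γ η V Z ξ x₀ k ω‖ ^ 2) ∂μ ≤
      ENNReal.ofReal (4 * L₀ ^ 2 * n / Real.pi) := by
  have := h.isProbability
  have hX := measurable_iterate (γ := γ) h.measurable hN x₀ k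
  have := Measure.isProbabilityMeasure_map (μ := μ) hX.aemeasurable
  have hm : Measurable fun p : Vec n × ℝ × Vec n × S =>
      ENNReal.ofReal (‖estimator G (η k) p.1 p.2.1 p.2.2.1 p.2.2.2‖ ^ 2) :=
    ((measurable_estimator h.measurable (η k)).norm.pow_const 2).ennreal_ofReal
  have h1 := lintegral_map (μ := μ) hm
    (measurable_iterate_prodMk_noise (γ := γ) h.measurable hN x₀ k)
  rw [map_iterate_noise h.measurable hN, lintegral_prod _ hm.aemeasurable] at h1
  refine h1.symm.le.trans ((lintegral_mono fun x =>
    h.lintegral_norm_estimator_sq_le hL (hη k) x).trans ?_)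
  simp

lemma memLp_stepDirection (h : DecisionIndependent Q G f L₀) (hL : 0 ≤ L₀)
    (hη : ∀ k, 0 < η k) (hN : IsNoise μ Q η V Z ξ) (x₀ : Vec n) (k : ℕ) :
    MemLp (stepDirection G γ η V Z ξ x₀ k) 2 μ := by
  have hm := measurable_stepDirection (γ := γ) h.measurable hN x₀ k
  refine (memLp_norm_iff hm.aestronglyMeasurable).1 ⟨hm.norm.aestronglyMeasurable, ?_⟩
  refine ((eLpNorm_two_le_iff (c := √(4 * L₀ ^ 2 * n / Real.pi)) (by positivity)).2 ?_).trans_lt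
    ENNReal.ofReal_lt_top
  rw [Real.sq_sqrt (by positivity)]
  exact lintegral_norm_stepDirection_sq_le h hL hη hN x₀ k

lemma integral_norm_stepDirection_sq_le (h : DecisionIndependent Q G f L₀) (hL : 0 ≤ L₀)
    (hη : ∀ k, 0 < η k) (hN : IsNoise μ Q η V Z ξ) (x₀ : Vec n) (k : ℕ) :
    ∫ ω, ‖stepDirection G γ η V Z ξ x₀ k ω‖ ^ 2 ∂μ ≤ 4 * L₀ ^ 2 * n / Real.pi := by
  have hm := measurable_stepDirection (γ := γ) h.measurable hN x₀ k
  rw [integral_eq_lintegral_of_nonneg_ae (Filter.Eventually.of_forall fun ω => by positivity)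
    (hm.norm.pow_const 2).aestronglyMeasurable]
  exact ENNReal.toReal_le_of_le_ofReal (by positivity)
    (lintegral_norm_stepDirection_sq_le h hL hη hN x₀ k)

lemma integrable_iterate (h : DecisionIndependent Q G f L₀) (hL : 0 ≤ L₀)
    (hη : ∀ k, 0 < η k) (hN : IsNoise μ Q η V Z ξ) (x₀ : Vec n) (k : ℕ) :
    Integrable (iterate G γ η V Z ξ x₀ k) μ := by
  induction k with
  | zero => exact integrable_const x₀
  | succ k ih =>
    exact ih.sub (((memLp_stepDirection h hL hη hN x₀ k).integrable one_le_two).smul (γ k))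

lemma integrable_smoothed_iterate (h : DecisionIndependent Q G f L₀) (hL : 0 ≤ L₀)
    (hη : ∀ k, 0 < η k) (hN : IsNoise μ Q η V Z ξ) (x₀ : Vec n) {η' : ℝ} (hη' : 0 < η') (k : ℕ) :
    Integrable (fun ω => smoothed η' f (iterate G γ η V Z ξ x₀ k ω)) μ := by
  have hl := lipschitzWith_smoothed (h.lipschitzWith hL) hη'
  have hx := integrable_iterate (γ := γ) h hL hη hN x₀ k
  refine ((integrable_const |smoothed η' f 0|).add (hx.norm.const_mul L₀)).mono'
    (hl.continuous.comp_aestronglyMeasurable hx.aestronglyMeasurable)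
    (Filter.Eventually.of_forall fun ω => ?_)
  have := hl.dist_le_mul (iterate G γ η V Z ξ x₀ k ω) 0
  rw [Real.dist_eq, dist_zero_right, Real.coe_toNNReal _ hL] at this
  rw [Real.norm_eq_abs]
  calc |smoothed η' f (iterate G γ η V Z ξ x₀ k ω)|
      = |smoothed η' f 0 + (smoothed η' f (iterate G γ η V Z ξ x₀ k ω) - smoothed η' f 0)| := by
        congr 1; ring
    _ ≤ _ := (abs_add_le _ _).trans (by simp only [Pi.add_apply]; gcongr)

lemma integrable_norm_gradient_sq (h : DecisionIndependent Q G f L₀) (hL : 0 ≤ L₀)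
    (hN : IsNoise μ Q η V Z ξ) (x₀ : Vec n) {η' : ℝ} (hη' : 0 < η') (k : ℕ) :
    Integrable (fun ω => ‖gradient (smoothed η' f) (iterate G γ η V Z ξ x₀ k ω)‖ ^ 2) μ := by
  have hl := h.lipschitzWith hL
  have hx := measurable_iterate (γ := γ) h.measurable hN x₀ k
  have hc := continuous_gradient_smoothed hl hη'
  refine (integrable_const (L₀ ^ 2)).mono'
    ((hc.measurable.comp hx).norm.pow_const 2).aestronglyMeasurable
    (Filter.Eventually.of_forall fun ω => ?_)
  rw [norm_pow, norm_norm]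
  have := norm_gradient_smoothed_le hl hη' (iterate G γ η V Z ξ x₀ k ω)
  rw [Real.coe_toNNReal _ hL] at this
  gcongr

/-- The joint law of iterate and fresh noise is a product, so integrating over the noise first
replaces the step direction by its mean, the gradient. Fubini takes the place of conditioning. -/
lemma integral_inner_stepDirection (h : DecisionIndependent Q G f L₀) (hL : 0 ≤ L₀)
    (hη : ∀ k, 0 < η k) (hN : IsNoise μ Q η V Z ξ) (x₀ : Vec n) (k : ℕ) :
    Integrable (fun ω => inner ℝ (gradient (smoothed (η k) f) (iterate G γ η V Z ξ x₀ k ω))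
      (stepDirection G γ η V Z ξ x₀ k ω)) μ ∧
    ∫ ω, inner ℝ (gradient (smoothed (η k) f) (iterate G γ η V Z ξ x₀ k ω))
      (stepDirection G γ η V Z ξ x₀ k ω) ∂μ =
      ∫ ω, ‖gradient (smoothed (η k) f) (iterate G γ η V Z ξ x₀ k ω)‖ ^ 2 ∂μ := by
  have := h.isProbability
  have hl := h.lipschitzWith hL
  have hx := measurable_iterate (γ := γ) h.measurable hN x₀ k
  have := Measure.isProbabilityMeasure_map (μ := μ) hx.aemeasurable
  have hg := measurable_stepDirection (γ := γ) h.measurable hN x₀ k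
  have hc := (continuous_gradient_smoothed hl (hη k)).measurable
  have hi : Integrable (fun ω => inner ℝ (gradient (smoothed (η k) f)
      (iterate G γ η V Z ξ x₀ k ω)) (stepDirection G γ η V Z ξ x₀ k ω)) μ := by
    refine (((memLp_stepDirection (γ := γ) h hL hη hN x₀ k).integrable one_le_two).norm.const_mul
      L₀).mono' ((hc.comp hx).inner hg).aestronglyMeasurable
      (Filter.Eventually.of_forall fun ω => ?_)
    refine (norm_inner_le_norm _ _).trans ?_
    have := norm_gradient_smoothed_le hl (hη k) (iterate G γ η V Z ξ x₀ k ω)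
    rw [Real.coe_toNNReal _ hL] at this
    gcongr
  refine ⟨hi, ?_⟩
  have hpm := measurable_iterate_prodMk_noise (γ := γ) h.measurable hN x₀ k
  have hm : Measurable fun p : Vec n × ℝ × Vec n × S =>
      inner ℝ (gradient (smoothed (η k) f) p.1) (estimator G (η k) p.1 p.2.1 p.2.2.1 p.2.2.2) :=
    (hc.comp measurable_fst).inner (measurable_estimator h.measurable (η k))
  have h1 := integral_map (μ := μ) hpm.aemeasurable hm.aestronglyMeasurable
  have hi2 := (integrable_map_measure (μ := μ) hm.aestronglyMeasurable hpm.aemeasurable).2 hi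
  rw [map_iterate_noise h.measurable hN] at h1 hi2
  refine h1.symm.trans ((integral_prod _ hi2).trans ?_)
  rw [← integral_map hx.aemeasurable
    (f := fun x => ‖gradient (smoothed (η k) f) x‖ ^ 2) (hc.norm.pow_const 2).aestronglyMeasurable]
  refine integral_congr_ae (Filter.Eventually.of_forall fun x => ?_)
  simp only
  rw [integral_inner ((h.memLp_estimator hL (hη k) x).integrable one_le_two),
    h.integral_estimator hL (hη k), real_inner_self_eq_norm_sq]

/-- The constant in front of `γ_k² / η_k` in the stationarity estimate. -/
def noiseConst (n : ℕ) (L₀ : ℝ) : ℝ :=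
  4 * L₀ ^ 3 * (n : ℝ) ^ (3 / 2 : ℝ) / (√2 * Real.pi ^ (3 / 2 : ℝ))

lemma rpow_three_halves {a : ℝ} (ha : 0 ≤ a) : a ^ (3 / 2 : ℝ) = a * √a := by
  rw [Real.sqrt_eq_rpow, show (3 / 2 : ℝ) = 1 + 1 / 2 by norm_num,
    Real.rpow_add_of_nonneg ha zero_le_one (by norm_num), Real.rpow_one]

lemma smoothness_mul_eq (n : ℕ) (L₀ : ℝ) {η : ℝ} (hη : 0 < η) (γ : ℝ) :
    smoothness n L₀ η / 2 * (γ ^ 2 * (4 * L₀ ^ 2 * n / Real.pi)) =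
      noiseConst n L₀ * (γ ^ 2 / η) := by
  have := Real.pi_pos
  rw [smoothness, noiseConst, rpow_three_halves (by positivity), rpow_three_halves this.le,
    Real.sqrt_mul (by norm_num)]
  field_simp

/-- The descent lemma in mean: unbiasedness handles the linear term, the second-moment bound the
quadratic one. -/
lemma integral_smoothed_iterate_succ_le (h : DecisionIndependent Q G f L₀) (hL : 0 ≤ L₀)
    (hη : ∀ k, 0 < η k) (hN : IsNoise μ Q η V Z ξ) (x₀ : Vec n) (k : ℕ) :
    ∫ ω, smoothed (η k) f (iterate G γ η V Z ξ x₀ (k + 1) ω) ∂μ ≤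
      ∫ ω, smoothed (η k) f (iterate G γ η V Z ξ x₀ k ω) ∂μ -
        γ k * ∫ ω, ‖gradient (smoothed (η k) f) (iterate G γ η V Z ξ x₀ k ω)‖ ^ 2 ∂μ +
        noiseConst n L₀ * (γ k ^ 2 / η k) := by
  have hl := h.lipschitzWith hL
  obtain ⟨hi, he⟩ := integral_inner_stepDirection (γ := γ) h hL hη hN x₀ k
  have hs := integrable_smoothed_iterate (γ := γ) h hL hη hN x₀ (hη k)
  have hg := (memLp_stepDirection (γ := γ) h hL hη hN x₀ k).norm.integrable_sq
  have hsm : 0 ≤ smoothness n L₀ (η k) := by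
    have := smoothness_nonneg (n := n) (C := L₀.toNNReal) (hη k)
    rwa [Real.coe_toNNReal _ hL] at this
  have hlip := norm_gradient_smoothed_sub_le hl (hη k)
  rw [Real.coe_toNNReal _ hL] at hlip
  have hpt : ∀ ω, smoothed (η k) f (iterate G γ η V Z ξ x₀ (k + 1) ω) ≤
      smoothed (η k) f (iterate G γ η V Z ξ x₀ k ω) -
        γ k * inner ℝ (gradient (smoothed (η k) f) (iterate G γ η V Z ξ x₀ k ω))
          (stepDirection G γ η V Z ξ x₀ k ω) +
        smoothness n L₀ (η k) / 2 * γ k ^ 2 * ‖stepDirection G γ η V Z ξ x₀ k ω‖ ^ 2 := fun ω => by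
    have h1 := le_add_inner_add_of_lipschitz_gradient (differentiable_smoothed hl (hη k)) hlip
      (iterate G γ η V Z ξ x₀ k ω) (-(γ k • stepDirection G γ η V Z ξ x₀ k ω))
    rw [← sub_eq_add_neg, inner_neg_right, real_inner_smul_right, norm_neg, norm_smul, mul_pow,
      Real.norm_eq_abs, sq_abs] at h1
    refine le_trans h1 (le_of_eq ?_)
    ring
  have h2 := integral_mono (hs (k + 1)) (((hs k).sub (hi.const_mul (γ k))).add
    (hg.const_mul (smoothness n L₀ (η k) / 2 * γ k ^ 2))) hpt
  refine h2.trans ?_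
  rw [integral_add' ((hs k).sub (hi.const_mul (γ k))) (hg.const_mul _),
    integral_sub' (hs k) (hi.const_mul (γ k)), integral_const_mul, integral_const_mul, he]
  rw [← smoothness_mul_eq n L₀ (hη k), mul_assoc]
  gcongr
  exact integral_norm_stepDirection_sq_le h hL hη hN x₀ k

/-- Telescoping with a moving objective: each change of the smoothing parameter costs `L₀ √n |η_k -
η_{k-1}|`, and passing from `f_{η_0}` to `f` at `x₀` costs `L₀ √n η_0`. The last smoothed value is
kept for the lower bound `inf f`. -/
lemma sum_mul_integral_le (h : DecisionIndependent Q G f L₀) (hL : 0 ≤ L₀)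
    (hη : ∀ k, 0 < η k) (hN : IsNoise μ Q η V Z ξ) (x₀ : Vec n) (m : ℕ) :
    ∑ k ∈ Finset.range (m + 1),
        γ k * ∫ ω, ‖gradient (smoothed (η k) f) (iterate G γ η V Z ξ x₀ k ω)‖ ^ 2 ∂μ ≤
      f x₀ + L₀ * √n * η 0 + L₀ * √n * ∑ k ∈ Finset.Ico 1 (m + 1), |η k - η (k - 1)| +
        noiseConst n L₀ * ∑ k ∈ Finset.range (m + 1), γ k ^ 2 / η k -
        ∫ ω, smoothed (η m) f (iterate G γ η V Z ξ x₀ (m + 1) ω) ∂μ := by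
  have hl := h.lipschitzWith hL
  induction m with
  | zero =>
    have h1 := integral_smoothed_iterate_succ_le (γ := γ) h hL hη hN x₀ 0
    have h2 := smoothed_le_add hl (hη 0) x₀
    rw [Real.coe_toNNReal _ hL] at h2
    have h3 : ∫ ω, smoothed (η 0) f (iterate G γ η V Z ξ x₀ 0 ω) ∂μ = smoothed (η 0) f x₀ := by
      simp [iterate]
    rw [h3] at h1
    simp only [zero_add, Finset.sum_range_one, Finset.Ico_self, Finset.sum_empty, mul_zero,
      add_zero] at h1 ⊢
    linarith
  | succ m ih =>
    have h1 := integral_smoothed_iterate_succ_le (γ := γ) h hL hη hN x₀ (m + 1)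
    have h2 : ∫ ω, smoothed (η (m + 1)) f (iterate G γ η V Z ξ x₀ (m + 1) ω) ∂μ ≤
        ∫ ω, smoothed (η m) f (iterate G γ η V Z ξ x₀ (m + 1) ω) ∂μ +
          L₀ * √n * |η (m + 1) - η m| := by
      have hs := fun j => integrable_smoothed_iterate (γ := γ) h hL hη hN x₀ (hη j) (m + 1)
      have h3 := integral_mono (hs (m + 1)) ((hs m).add
        (integrable_const (L₀ * √n * |η (m + 1) - η m|))) fun ω => by
          have := abs_smoothed_sub_le hl (hη (m + 1)) (hη m) (iterate G γ η V Z ξ x₀ (m + 1) ω)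
          rw [Real.coe_toNNReal _ hL] at this
          simp only [Pi.add_apply]
          linarith [(abs_le.1 this).2]
      rw [integral_add' (hs m) (integrable_const _)] at h3
      simpa using h3
    rw [Finset.sum_range_succ, Finset.sum_range_succ _ (m + 1),
      Finset.sum_Ico_succ_top (by omega : 1 ≤ m + 1), Nat.add_sub_cancel]
    simp only [mul_add]
    linarith

theorem stationarity_estimate (h : DecisionIndependent Q G f L₀) (hL : 0 ≤ L₀)
    (hb : BddBelow (Set.range f)) (hγ : ∀ k, 0 < γ k) (hη : ∀ k, 0 < η k)
    (hN : IsNoise μ Q η V Z ξ) (x₀ : Vec n) {K : ℕ} (hK : 0 < K) :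
    (∑ k ∈ Finset.range K,
        γ k * ∫ ω, ‖gradient (smoothed (η k) f) (iterate G γ η V Z ξ x₀ k ω)‖ ^ 2 ∂μ) /
      (∑ k ∈ Finset.range K, γ k) ≤ stationarityBound f x₀ L₀ γ η K := by
  obtain ⟨m, rfl⟩ : ∃ m, K = m + 1 := ⟨K - 1, by omega⟩
  have hl := h.lipschitzWith hL
  have h1 := sum_mul_integral_le (γ := γ) h hL hη hN x₀ m
  have h2 : ⨅ y, f y ≤ ∫ ω, smoothed (η m) f (iterate G γ η V Z ξ x₀ (m + 1) ω) ∂μ := by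
    have := integral_mono (μ := μ) (integrable_const (⨅ y, f y))
      (integrable_smoothed_iterate (γ := γ) h hL hη hN x₀ (hη m) (m + 1))
      fun ω => iInf_le_smoothed hl hb (hη m) _
    simpa using this
  have hpos : 0 < ∑ k ∈ Finset.range (m + 1), γ k :=
    Finset.sum_pos (fun k _ => hγ k) (by simp)
  rw [stationarityBound, div_eq_inv_mul, one_div]
  gcongr
  have hsq : √(n : ℝ) ≤ √((n : ℝ) + 1) := Real.sqrt_le_sqrt (by linarith)
  -- The `η_K` term is slack: averaging never pushes `f_η` below `inf f`, so the final iterate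
  -- incurs no smoothing error.
  have h3 : L₀ * √n * η 0 ≤ L₀ * √(n + 1) * (η 0 + η (m + 1)) := by
    have := (hη 0).le
    gcongr
    linarith [hη (m + 1)]
  have h4 : L₀ * √n * ∑ k ∈ Finset.Ico 1 (m + 1), |η k - η (k - 1)| ≤
      L₀ * √(n + 1) * ∑ k ∈ Finset.Ico 1 (m + 1), |η k - η (k - 1)| := by
    gcongr
  have h5 : noiseConst n L₀ =
    4 * L₀ ^ 3 * (n : ℝ) ^ (3 / 2 : ℝ) / (√2 * Real.pi ^ (3 / 2 : ℝ)) := rfl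
  rw [← h5]
  linarith

end Scheme

/-! ### The random index -/

section RandomIndex

variable {n : ℕ} {Ω : Type w} [MeasurableSpace Ω] {μ : Measure Ω}
  {γ : ℕ → ℝ} {x : ℕ → Ω → Vec n} {K : ℕ} {R : Ω → ℕ}

/-- Split according to the value of `R`; independence factors each piece into `ℙ[R = j]` times a
mean. -/
lemma IsRandomIndex.integral_eq (hR : IsRandomIndex μ γ x K R) (hγ : ∀ k, 0 < γ k)
    {φ : ℕ → Vec n → ℝ} (hφ : ∀ k, Measurable (φ k))
    (hi : ∀ k, Integrable (fun ω => φ k (x k ω)) μ) :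
    Integrable (fun ω => φ (R ω) (x (R ω) ω)) μ ∧
    ∫ ω, φ (R ω) (x (R ω) ω) ∂μ =
      (∑ k ∈ Finset.range K, γ k * ∫ ω, φ k (x k ω) ∂μ) / ∑ k ∈ Finset.range K, γ k := by
  have hset : ∀ j, MeasurableSet (R ⁻¹' {j}) := fun j => hR.measurable (measurableSet_singleton j)
  have hdec : (fun ω => φ (R ω) (x (R ω) ω)) = fun ω =>
      ∑ j ∈ Finset.range K, (R ⁻¹' {j}).indicator (fun _ => (1 : ℝ)) ω * φ j (x j ω) := by
    ext ω
    rw [Finset.sum_eq_single (R ω)]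
    · simp
    · intro j _ hj
      have : ω ∉ R ⁻¹' {j} := fun h => hj (Set.mem_singleton_iff.1 h).symm
      rw [Set.indicator_of_notMem this, zero_mul]
    · intro h
      exact absurd (Finset.mem_range.2 (hR.lt ω)) h
  have hint : ∀ j, Integrable (fun ω => (R ⁻¹' {j}).indicator (fun _ => (1 : ℝ)) ω * φ j (x j ω))
      μ := fun j => by
    have := (hi j).indicator (hset j)
    refine this.congr (Filter.Eventually.of_forall fun ω => ?_)
    by_cases h : ω ∈ R ⁻¹' {j} <;> simp [h]
  rw [hdec]
  refine ⟨integrable_finsetSum _ fun j _ => hint j, ?_⟩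
  rw [integral_finsetSum _ fun j _ => hint j, Finset.sum_div]
  refine Finset.sum_congr rfl fun j hj => ?_
  have hind : IndepFun (fun ω => (R ⁻¹' {j}).indicator (fun _ => (1 : ℝ)) ω)
      (fun ω => φ j (x j ω)) μ := by
    have hone : Measurable (fun r : ℕ => ({j} : Set ℕ).indicator (fun _ => (1 : ℝ)) r) :=
      measurable_of_countable _
    exact hR.indep.comp hone ((hφ j).comp (measurable_pi_apply j))
  have hmul := hind.integral_mul_eq_mul_integral
    ((measurable_const.indicator (hset j)).aestronglyMeasurable) (hi j).aestronglyMeasurable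
  refine hmul.trans ?_
  have hp : μ.real (R ⁻¹' {j}) = γ j / ∑ l ∈ Finset.range K, γ l := by
    rw [measureReal_def, hR.prob j (Finset.mem_range.1 hj), ENNReal.toReal_ofReal]
    exact div_nonneg (hγ j).le (Finset.sum_nonneg fun l _ => (hγ l).le)
  rw [integral_indicator_const _ (hset j), hp, smul_eq_mul, mul_one]
  ring

end RandomIndex

/-! ### Complexity -/

/-- This is `log t ≤ t - 1` at `t = K^(1/4)`. The fourth root is chosen so that the square of the
logarithmic factor costs only `√K`. -/
lemma one_add_log_le {K : ℝ} (hK : 0 < K) : 1 + Real.log K ≤ 4 * √(√K) := by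
  have h1 := Real.log_le_sub_one_of_pos (Real.sqrt_pos.2 (Real.sqrt_pos.2 hK))
  rw [Real.log_sqrt (Real.sqrt_nonneg _), Real.log_sqrt hK.le] at h1
  linarith

lemma one_add_log_sq_le {K : ℝ} (hK : 1 ≤ K) : (1 + Real.log K) ^ 2 ≤ 16 * √K := by
  have h0 := Real.log_nonneg hK
  have h1 := one_add_log_le (by linarith : 0 < K)
  calc (1 + Real.log K) ^ 2 ≤ (4 * √(√K)) ^ 2 := by gcongr
    _ = 16 * √K := by rw [mul_pow, Real.sq_sqrt (Real.sqrt_nonneg _)]; norm_num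

lemma withLog_nonneg {Y : ℝ} (hY : 0 ≤ Y) : 0 ≤ withLog Y := by
  unfold withLog
  positivity

/-- A self-referential bound with logarithms, resolved. -/
lemma le_mul_withLog {K Y : ℝ} (hK : 1 ≤ K) (hY : 0 ≤ Y)
    (h : K ≤ 32 * Y * (1 + Real.log K) ^ 2) : K ≤ 6272 * withLog Y := by
  have hK0 : 0 < K := by linarith
  have h1 : K ≤ 512 * Y * √K := by
    have := one_add_log_sq_le hK
    calc K ≤ 32 * Y * (1 + Real.log K) ^ 2 := h
      _ ≤ 32 * Y * (16 * √K) := by gcongr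
      _ = _ := by ring
  -- A crude polynomial bound, good enough to be put back inside the logarithm.
  have h2 : √K ≤ 512 * Y := by
    have hs := Real.sqrt_pos.2 hK0
    have h3 := Real.mul_self_sqrt hK0.le
    by_contra hc
    push Not at hc
    nlinarith
  have hlog : Real.log K ≤ 18 * Real.log 2 + 2 * Real.log (1 + Y) := by
    have h3 : K ≤ 2 ^ 18 * (1 + Y) ^ 2 := by
      rw [← Real.sq_sqrt hK0.le]
      calc √K ^ 2 ≤ (512 * Y) ^ 2 := by gcongr
        _ = 2 ^ 18 * Y ^ 2 := by ring
        _ ≤ _ := by gcongr; linarith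
    have h4 := Real.log_le_log hK0 h3
    rw [Real.log_mul (by positivity) (by positivity), Real.log_pow, Real.log_pow] at h4
    exact_mod_cast h4
  have hl2 : Real.log 2 < 0.6931471808 := Real.log_two_lt_d9
  have hly : 0 ≤ Real.log (1 + Y) := Real.log_nonneg (by linarith)
  -- Here `1 + 18 log 2 < 14`, and `6272 = 32 * 14²`.
  have h5 : 1 + Real.log K ≤ 14 * (1 + Real.log (1 + Y)) := by linarith
  have h6 := Real.log_nonneg hK
  calc K ≤ 32 * Y * (1 + Real.log K) ^ 2 := h
    _ ≤ 32 * Y * (14 * (1 + Real.log (1 + Y))) ^ 2 := by gcongr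
    _ = 6272 * withLog Y := by rw [withLog]; ring

/-- Logarithms of products add, and `1 + a + b ≤ (1 + a) (1 + b)`; a factor `1 + t` can thus be
moved into a constant depending on `t` alone. -/
lemma withLog_le_of_le_mul {Y Y' t : ℝ} (hY : 0 ≤ Y) (hY' : 0 ≤ Y') (ht : 0 ≤ t)
    (h : Y ≤ (1 + t) * Y') :
    withLog Y ≤ (1 + t) * (1 + Real.log (1 + t)) ^ 2 * withLog Y' := by
  have h1 : Real.log (1 + Y) ≤ Real.log (1 + t) + Real.log (1 + Y') := by
    rw [← Real.log_mul (by positivity) (by positivity)]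
    exact Real.log_le_log (by positivity) (by nlinarith)
  have ha : 0 ≤ Real.log (1 + t) := Real.log_nonneg (by linarith)
  have hb : 0 ≤ Real.log (1 + Y') := Real.log_nonneg (by linarith)
  have hc : 0 ≤ Real.log (1 + Y) := Real.log_nonneg (by linarith)
  have h2 : 1 + Real.log (1 + Y) ≤ (1 + Real.log (1 + t)) * (1 + Real.log (1 + Y')) := by
    nlinarith
  unfold withLog
  calc Y * (1 + Real.log (1 + Y)) ^ 2
      ≤ ((1 + t) * Y') * ((1 + Real.log (1 + t)) * (1 + Real.log (1 + Y'))) ^ 2 := by gcongr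
    _ = _ := by ring

/-! ### Step-size sums and the resulting rate -/

lemma sqrt_le_sum_inv_sqrt (K : ℕ) : √(K : ℝ) ≤ ∑ k ∈ Finset.range K, 1 / √((k : ℝ) + 1) := by
  rcases Nat.eq_zero_or_pos K with rfl | hK
  · simp
  have hKr : (0 : ℝ) < K := by exact_mod_cast hK
  calc √(K : ℝ) = ∑ _k ∈ Finset.range K, 1 / √(K : ℝ) := by
        rw [Finset.sum_const, Finset.card_range, nsmul_eq_mul, mul_one_div, Real.div_sqrt]
    _ ≤ _ := by
        refine Finset.sum_le_sum fun k hk => ?_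
        have : (k : ℝ) + 1 ≤ K := by exact_mod_cast Finset.mem_range.1 hk
        gcongr

lemma sum_inv_le_one_add_log (K : ℕ) :
    ∑ k ∈ Finset.range K, 1 / ((k : ℝ) + 1) ≤ 1 + Real.log K := by
  have h := harmonic_le_one_add_log K
  rw [harmonic] at h
  push_cast at h
  simpa using h

lemma noiseConst_le (n : ℕ) {L₀ : ℝ} (hL : 0 ≤ L₀) : noiseConst n L₀ ≤ L₀ ^ 3 * (n * √n) := by
  have hpi := Real.pi_gt_three
  rw [noiseConst, rpow_three_halves (by positivity), rpow_three_halves (by positivity),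
    div_le_iff₀ (by positivity)]
  have h1 : (1 : ℝ) ≤ √2 := Real.one_le_sqrt.2 (by norm_num)
  have h2 : (1.5 : ℝ) ≤ √Real.pi := Real.le_sqrt_of_sq_le (by norm_num; linarith)
  have h3 : 4 ≤ √2 * (Real.pi * √Real.pi) := by
    calc (4 : ℝ) ≤ 1 * (3 * 1.5) := by norm_num
      _ ≤ _ := by gcongr
  have h4 : 0 ≤ L₀ ^ 3 * (n * √(n : ℝ)) := by positivity
  nlinarith

/-- The step sizes `η / (L₀ √n √(k + 1))` turn the stationarity estimate into a rate
`(1 + log K) / √K`. -/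
lemma stationarityBound_le {n : ℕ} (hn : 0 < n) {f : Vec n → ℝ} (hb : BddBelow (Set.range f))
    (x₀ : Vec n) {L₀ η : ℝ} (hL : 0 < L₀) (hη : 0 < η) {γ : ℕ → ℝ}
    (hγ : ∀ k : ℕ, γ k = η / (L₀ * √n * √((k : ℝ) + 1))) {K : ℕ} (hK : 0 < K) :
    stationarityBound f x₀ L₀ γ (fun _ => η) K ≤
      4 * (L₀ * √n * (f x₀ - ⨅ y, f y) / η + L₀ ^ 2 * n) * (1 + Real.log K) / √K := by
  have hnr : (1 : ℝ) ≤ n := by exact_mod_cast hn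
  have hKr : (1 : ℝ) ≤ K := by exact_mod_cast hK
  set Δ := f x₀ - ⨅ y, f y with hΔ
  have hΔ0 : 0 ≤ Δ := sub_nonneg.2 (ciInf_le hb x₀)
  have hlog := Real.log_nonneg hKr
  have hsn : 0 < √(n : ℝ) := Real.sqrt_pos.2 (by linarith)
  have hsn2 : √(n : ℝ) * √n = n := Real.mul_self_sqrt (by linarith)
  have hsum : η / (L₀ * √n) * √K ≤ ∑ k ∈ Finset.range K, γ k := by
    have : ∑ k ∈ Finset.range K, γ k =
        η / (L₀ * √n) * ∑ k ∈ Finset.range K, 1 / √((k : ℝ) + 1) := by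
      rw [Finset.mul_sum]
      refine Finset.sum_congr rfl fun k _ => ?_
      rw [hγ, div_mul_div_comm, mul_one]
    rw [this]
    gcongr
    exact sqrt_le_sum_inv_sqrt K
  have hsq : ∑ k ∈ Finset.range K, γ k ^ 2 / η ≤ η / (L₀ ^ 2 * n) * (1 + Real.log K) := by
    have : ∑ k ∈ Finset.range K, γ k ^ 2 / η =
        η / (L₀ ^ 2 * n) * ∑ k ∈ Finset.range K, 1 / ((k : ℝ) + 1) := by
      rw [Finset.mul_sum]
      refine Finset.sum_congr rfl fun k _ => ?_
      rw [hγ, div_pow, mul_pow, mul_pow, Real.sq_sqrt (by positivity), Real.sq_sqrt (by positivity)]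
      field_simp
    rw [this]
    gcongr
    exact sum_inv_le_one_add_log K
  -- For `n ≥ 1` one has `n + 1 ≤ 9n / 4`.
  have hs1 : √((n : ℝ) + 1) ≤ 3 / 2 * √n := by
    rw [Real.sqrt_le_left (by positivity), mul_pow, Real.sq_sqrt (by positivity)]
    linarith
  -- The factor `4` collects `3` from the two smoothing errors and `1` from the noise; the variation
  -- sum is zero.
  have hnum : Δ + L₀ * √(n + 1) * ∑ k ∈ Finset.Ico 1 K, |(fun _ : ℕ => η) k - η| +
      L₀ * √(n + 1) * (η + η) + noiseConst n L₀ * ∑ k ∈ Finset.range K, γ k ^ 2 / η ≤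
      4 * (Δ + L₀ * √n * η) * (1 + Real.log K) := by
    have e1 : L₀ * √(n + 1) * (η + η) ≤ 3 * (L₀ * √n * η) := by
      calc L₀ * √(n + 1) * (η + η) ≤ L₀ * (3 / 2 * √n) * (η + η) := by gcongr
        _ = _ := by ring
    have e2 : noiseConst n L₀ * ∑ k ∈ Finset.range K, γ k ^ 2 / η ≤
        L₀ * √n * η * (1 + Real.log K) := by
      calc noiseConst n L₀ * ∑ k ∈ Finset.range K, γ k ^ 2 / η
          ≤ L₀ ^ 3 * (n * √n) * (η / (L₀ ^ 2 * n) * (1 + Real.log K)) := by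
            gcongr
            exact noiseConst_le n hL.le
        _ = _ := by field_simp
    have e3 : 0 ≤ L₀ * √n * η := by positivity
    simp only [sub_self, abs_zero, Finset.sum_const_zero, mul_zero, add_zero]
    nlinarith [mul_nonneg e3 hlog, mul_nonneg hΔ0 hlog]
  have hnum0 : 0 ≤ 4 * (Δ + L₀ * √n * η) * (1 + Real.log K) := by positivity
  have hsum0 : 0 < η / (L₀ * √n) * √K := by positivity
  calc stationarityBound f x₀ L₀ γ (fun _ => η) K
      ≤ 1 / (∑ k ∈ Finset.range K, γ k) * (4 * (Δ + L₀ * √n * η) * (1 + Real.log K)) := by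
        unfold stationarityBound
        have : 0 ≤ 1 / (∑ k ∈ Finset.range K, γ k) := one_div_nonneg.2 (hsum0.le.trans hsum)
        exact mul_le_mul_of_nonneg_left hnum this
    _ ≤ 1 / (η / (L₀ * √n) * √K) * (4 * (Δ + L₀ * √n * η) * (1 + Real.log K)) := by
        gcongr
    _ = _ := by
        rw [show L₀ ^ 2 * (n : ℝ) = L₀ ^ 2 * (√n * √n) by rw [hsn2]]
        have := hsn.ne'
        generalize √(n : ℝ) = r at this ⊢
        field_simp

/-- The rate `(1 + log K) / √K` drops below `ε²` once `K` exceeds `32 Y (1 + log K)²`. -/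
lemma rate_le_sq {a b ε K : ℝ} (ha : 0 ≤ a) (hb : 0 ≤ b) (hε : 0 < ε) (hK : 1 ≤ K)
    (h : 32 * ((a ^ 2 + b ^ 2) / ε ^ 4) * (1 + Real.log K) ^ 2 ≤ K) :
    4 * (a + b) * (1 + Real.log K) / √K ≤ ε ^ 2 := by
  have hlog := Real.log_nonneg hK
  have hK0 : 0 < √K := Real.sqrt_pos.2 (by linarith)
  rw [div_le_iff₀ hK0]
  -- Squares are compared; `32 = 16 * 2` comes from `(a + b)² ≤ 2 (a² + b²)`.
  have h1 : (4 * (a + b) * (1 + Real.log K)) ^ 2 ≤ (ε ^ 2 * √K) ^ 2 := by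
    rw [mul_pow (ε ^ 2), Real.sq_sqrt (by linarith)]
    calc (4 * (a + b) * (1 + Real.log K)) ^ 2
        = 16 * (a + b) ^ 2 * (1 + Real.log K) ^ 2 := by ring
      _ ≤ 16 * (2 * (a ^ 2 + b ^ 2)) * (1 + Real.log K) ^ 2 := by
        gcongr
        nlinarith [sq_nonneg (a - b)]
      _ = (ε ^ 2) ^ 2 * (32 * ((a ^ 2 + b ^ 2) / ε ^ 4) * (1 + Real.log K) ^ 2) := by
        field_simp
        ring
      _ ≤ _ := by gcongr
  exact (pow_le_pow_iff_left₀ (by positivity) (by positivity) two_ne_zero).1 h1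

lemma exists_rate_le (Y : ℝ) (hY : 0 ≤ Y) :
    ∃ K : ℕ, 0 < K ∧ 32 * Y * (1 + Real.log K) ^ 2 ≤ K := by
  obtain ⟨m, hm⟩ := exists_nat_ge ((512 * Y) ^ 2)
  refine ⟨m + 1, m.succ_pos, ?_⟩
  have hK : (1 : ℝ) ≤ ((m + 1 : ℕ) : ℝ) := by push_cast; linarith [m.cast_nonneg (α := ℝ)]
  have h1 : 512 * Y ≤ √((m + 1 : ℕ) : ℝ) := by
    refine Real.le_sqrt_of_sq_le (hm.trans ?_)
    push_cast
    linarith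
  calc 32 * Y * (1 + Real.log ((m + 1 : ℕ) : ℝ)) ^ 2
      ≤ 32 * Y * (16 * √((m + 1 : ℕ) : ℝ)) := by gcongr; exact one_add_log_sq_le hK
    _ = 512 * Y * √((m + 1 : ℕ) : ℝ) := by ring
    _ ≤ √((m + 1 : ℕ) : ℝ) * √((m + 1 : ℕ) : ℝ) := by gcongr
    _ = _ := Real.mul_self_sqrt (by linarith)

/-- The predecessor of the least element is not in `s`, so it violates the test and obeys the
self-referential bound; this is the source of the `1 +`. No monotonicity of `s` is required. -/
lemma sInf_le_one_add_mul_withLog {s : Set ℕ} {Y : ℝ} (hY : 0 ≤ Y)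
    (hs : ∀ K : ℕ, 0 < K → 32 * Y * (1 + Real.log K) ^ 2 ≤ K → K ∈ s) :
    s.Nonempty ∧ ((sInf s : ℕ) : ℝ) ≤ 1 + 6272 * withLog Y := by
  obtain ⟨K₀, hK₀, hr⟩ := exists_rate_le Y hY
  refine ⟨⟨K₀, hs K₀ hK₀ hr⟩, ?_⟩
  have hw := withLog_nonneg hY
  rcases Nat.lt_or_ge (sInf s) 2 with h | h
  · have : ((sInf s : ℕ) : ℝ) ≤ 1 := by exact_mod_cast Nat.lt_succ_iff.1 h
    linarith
  · obtain ⟨m, hm⟩ : ∃ m, sInf s = m + 1 := ⟨sInf s - 1, by omega⟩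
    have hm1 : 0 < m := by omega
    have hnot : m ∉ s := Nat.notMem_of_lt_sInf (by omega)
    have hlt : (m : ℝ) ≤ 32 * Y * (1 + Real.log m) ^ 2 := by
      by_contra hc
      exact hnot (hs m hm1 (not_le.1 hc).le)
    have := le_mul_withLog (by exact_mod_cast hm1) hY hlt
    rw [hm]
    push_cast
    linarith

/-! ### Counting oracle calls -/

lemma length_estimatorCalls {n : ℕ} {S : Type*} (η : ℝ) (x : Vec n) (v : ℝ) (z : Vec n) (s : S) :
    (estimatorCalls η x v z s).length = 2 * n := by
  simp [estimatorCalls, List.length_flatMap, mul_comm]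

lemma length_oracleCalls {n : ℕ} {S Ω : Type*} (G : Vec n → S → ℝ) (γ η : ℕ → ℝ) (V : ℕ → Ω → ℝ)
    (Z : ℕ → Ω → Vec n) (ξ : ℕ → Ω → S) (x₀ : Vec n) (K : ℕ) (ω : Ω) :
    (oracleCalls G γ η V Z ξ x₀ K ω).length = 2 * n * K := by
  simp [oracleCalls, List.length_flatMap, length_estimatorCalls, mul_comm]

end ESGS

end

theorem proposition5p4 :
    -- stationarity estimates for arbitrary positive step sizes and smoothing parameters
    (∀ {n : ℕ} (_ : 0 < n) {S : Type u} [MeasurableSpace S] (Q : Measure S)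
      (G : ESGS.Vec n → S → ℝ) (f : ESGS.Vec n → ℝ) (L₀ : ℝ) (_ : 0 ≤ L₀)
      (_ : ESGS.Regime Q G f L₀) (_ : BddBelow (Set.range f))
      (γ η : ℕ → ℝ) (_ : ∀ k, 0 < γ k) (_ : ∀ k, 0 < η k)
      {Ω : Type w} [MeasurableSpace Ω] (μ : Measure Ω) [IsProbabilityMeasure μ]
      (V : ℕ → Ω → ℝ) (Z : ℕ → Ω → ESGS.Vec n) (ξ : ℕ → Ω → S) (_ : ESGS.IsNoise μ Q η V Z ξ)
      (x₀ : ESGS.Vec n) (x : ℕ → Ω → ESGS.Vec n) (_ : x = ESGS.iterate G γ η V Z ξ x₀),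
      (∀ k, Differentiable ℝ (ESGS.smoothed (η k) f)) ∧
      (∀ k, Integrable (fun ω => ‖gradient (ESGS.smoothed (η k) f) (x k ω)‖ ^ 2) μ) ∧
      (∀ K : ℕ, 0 < K →
        (∑ k ∈ Finset.range K,
            γ k * ∫ ω, ‖gradient (ESGS.smoothed (η k) f) (x k ω)‖ ^ 2 ∂μ) /
          (∑ k ∈ Finset.range K, γ k) ≤ ESGS.stationarityBound f x₀ L₀ γ η K) ∧
      (∀ K : ℕ, 0 < K → ∀ R : Ω → ℕ, ESGS.IsRandomIndex μ γ x K R →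
        Integrable (fun ω => ‖gradient (ESGS.smoothed (η (R ω)) f) (x (R ω) ω)‖ ^ 2) μ ∧
        ∫ ω, ‖gradient (ESGS.smoothed (η (R ω)) f) (x (R ω) ω)‖ ^ 2 ∂μ ≤
          ESGS.stationarityBound f x₀ L₀ γ η K)) ∧
    -- iteration and sample complexity for a constant smoothing parameter
    (∃ (C : ℝ) (C' : ℝ → ℝ),
      ∀ {n : ℕ} (_ : 0 < n) {S : Type u} [MeasurableSpace S] (Q : Measure S)
      (G : ESGS.Vec n → S → ℝ) (f : ESGS.Vec n → ℝ) (L₀ : ℝ) (_ : 0 < L₀)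
      (_ : ESGS.Regime Q G f L₀) (_ : BddBelow (Set.range f))
      (η ε : ℝ) (_ : 0 < η) (_ : 0 < ε)
      (γ : ℕ → ℝ) (_ : ∀ k : ℕ, γ k = η / (L₀ * √n * √((k : ℝ) + 1)))
      {Ω : Type w} [MeasurableSpace Ω] (μ : Measure Ω) [IsProbabilityMeasure μ]
      (V : ℕ → Ω → ℝ) (Z : ℕ → Ω → ESGS.Vec n) (ξ : ℕ → Ω → S)
      (_ : ESGS.IsNoise μ Q (fun _ => η) V Z ξ)
      (x₀ : ESGS.Vec n) (x : ℕ → Ω → ESGS.Vec n)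
      (_ : x = ESGS.iterate G γ (fun _ => η) V Z ξ x₀)
      (R : ℕ → Ω → ℕ) (_ : ∀ K : ℕ, 0 < K → ESGS.IsRandomIndex μ γ x K (R K))
      (Δ : ℝ) (_ : Δ = f x₀ - ⨅ y, f y)
      (N : ℕ) (_ : N = ESGS.iterationComplexity μ f η ε x R)
      (Y Y' : ℝ) (_ : Y = (L₀ ^ 2 * n * Δ ^ 2 / η ^ 2 + L₀ ^ 4 * n ^ 2) / ε ^ 4)
      (_ : Y' = (L₀ ^ 2 * n / η + L₀ ^ 4 * n ^ 2) / ε ^ 4),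
      (ESGS.stationarySteps μ f η ε x R).Nonempty ∧
      (N : ℝ) ≤ 1 + C * ESGS.withLog Y ∧
      (N : ℝ) ≤ 1 + C' (Δ ^ 2 / η) * ESGS.withLog Y' ∧
      ∀ ω, ∀ s : ℕ, s = (ESGS.oracleCalls G γ (fun _ => η) V Z ξ x₀ N ω).length →
        (s : ℝ) ≤ 2 * n * (1 + C * ESGS.withLog Y) ∧
        (s : ℝ) ≤ 2 * n * (1 + C' (Δ ^ 2 / η) * ESGS.withLog Y')) := by
  -- The second constant is the first times the price of `Y ≤ (1 + t) Y'` with `t = Δ² / η`.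
  refine ⟨?_, 6272, fun t => 6272 * ((1 + t) * (1 + Real.log (1 + t)) ^ 2), ?_⟩
  · intro n _ S _ Q G f L₀ hL hreg hb γ η hγ hη Ω _ μ _ V Z ξ hN x₀ x hx
    subst hx
    have h := hreg.decisionIndependent
    have hl := h.lipschitzWith hL
    have hi := fun k => ESGS.integrable_norm_gradient_sq (γ := γ) h hL hN x₀ (hη k) k
    refine ⟨fun k => ESGS.differentiable_smoothed hl (hη k), hi,
      fun K hK => ESGS.stationarity_estimate h hL hb hγ hη hN x₀ hK, fun K hK R hR => ?_⟩
    obtain ⟨h1, h2⟩ := hR.integral_eq hγ (φ := fun k y => ‖gradient (ESGS.smoothed (η k) f) y‖ ^ 2)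
      (fun k => ((ESGS.continuous_gradient_smoothed hl (hη k)).norm.pow 2).measurable) hi
    exact ⟨h1, h2.le.trans (ESGS.stationarity_estimate h hL hb hγ hη hN x₀ hK)⟩
  · intro n hn S _ Q G f L₀ hL hreg hb η ε hη hε γ hγ Ω _ μ _ V Z ξ hN x₀ x hx R hR Δ hΔ N hNd
      Y Y' hY hY'
    subst hx hNd
    have h := hreg.decisionIndependent
    have hl := h.lipschitzWith hL.le
    have hnr : (0 : ℝ) < n := by exact_mod_cast hn
    have hγ0 : ∀ k, 0 < γ k := fun k => by rw [hγ]; positivity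
    have hΔ0 : 0 ≤ Δ := hΔ ▸ sub_nonneg.2 (ciInf_le hb x₀)
    have hY0 : 0 ≤ Y := by rw [hY]; positivity
    have hY0' : 0 ≤ Y' := by rw [hY']; positivity
    have hi := fun k => ESGS.integrable_norm_gradient_sq (γ := γ) h hL.le hN x₀ hη k
    -- The two squares are those of the terms `a` and `b` in the rate `4 (a + b) (1 + log K) / √K`.
    have hYab : Y = ((L₀ * √n * Δ / η) ^ 2 + (L₀ ^ 2 * n) ^ 2) / ε ^ 4 := by
      rw [hY, div_pow, mul_pow, mul_pow, Real.sq_sqrt hnr.le]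
      ring
    have hmem : ∀ K : ℕ, 0 < K → 32 * Y * (1 + Real.log K) ^ 2 ≤ K →
        K ∈ ESGS.stationarySteps μ f η ε (ESGS.iterate G γ (fun _ => η) V Z ξ x₀) R := by
      intro K hK hKY
      obtain ⟨h1, h2⟩ := (hR K hK).integral_eq hγ0
        (φ := fun _ y => ‖gradient (ESGS.smoothed η f) y‖ ^ 2)
        (fun _ => ((ESGS.continuous_gradient_smoothed hl hη).norm.pow 2).measurable) hi
      refine ⟨hK, h1, h2.le.trans ?_⟩
      refine (ESGS.stationarity_estimate h hL.le hb hγ0 (fun _ => hη) hN x₀ hK).trans ?_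
      refine (ESGS.stationarityBound_le hn hb x₀ hL hη hγ hK).trans ?_
      rw [← hΔ]
      rw [hYab] at hKY
      exact ESGS.rate_le_sq (by positivity) (by positivity) hε (by exact_mod_cast hK) hKY
    obtain ⟨hne, hle⟩ := ESGS.sInf_le_one_add_mul_withLog hY0 hmem
    have hYY' : Y ≤ (1 + Δ ^ 2 / η) * Y' := by
      rw [hY, hY', ← mul_div_assoc]
      refine div_le_div_of_nonneg_right ?_ (by positivity)
      have e1 : L₀ ^ 2 * n * Δ ^ 2 / η ^ 2 = Δ ^ 2 / η * (L₀ ^ 2 * n / η) := by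
        field_simp
      have e2 : 0 ≤ Δ ^ 2 / η * (L₀ ^ 4 * n ^ 2) := by positivity
      have e3 : 0 ≤ L₀ ^ 2 * n / η := by positivity
      rw [e1]
      linarith
    have hle' : ((ESGS.iterationComplexity μ f η ε (ESGS.iterate G γ (fun _ => η) V Z ξ x₀) R : ℕ) :
        ℝ) ≤ 1 + 6272 * ((1 + Δ ^ 2 / η) * (1 + Real.log (1 + Δ ^ 2 / η)) ^ 2) *
          ESGS.withLog Y' := by
      have := ESGS.withLog_le_of_le_mul hY0 hY0' (by positivity) hYY'
      refine hle.trans ?_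
      rw [mul_assoc]
      linarith
    refine ⟨hne, hle, hle', fun ω s hs => ?_⟩
    rw [hs, ESGS.length_oracleCalls]
    push_cast
    exact ⟨mul_le_mul_of_nonneg_left hle (by positivity),
      mul_le_mul_of_nonneg_left hle' (by positivity)⟩
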